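/- Let $(w_k)_{k\ge 0}$ be i.i.d. square-integrable random vectors in $\mathbb{R}^d$ with mean zero and positive definite covariance matrix $\Sigma$. Let $f:\mathbb{R}^d\to\mathbb{R}$ be twice differentiable and, for some $L\in\mathbb{R}$ and $\sigma>0$, satisfy for all $x,y\in\mathbb{R}^d$ $$f(x)+\langle\nabla f(x),y-x\rangle+\tfrac{\sigma}{2}\|x-y\|_2^2\;\le\; f(y)\;\le\; f(x)+\langle\nabla f(x),y-x\rangle+\tfrac{L}{2}\|x-y\|_2^2$$ (that is, $f$ is $L$-smooth and $\sigma$-strongly convex). Then $f$ has a unique minimizer $x^*$. Let $H_f$ be the Hessian matrix of $f$ at $x^*$. For a stepsize $\alpha>0$ and an initial point $X_0^{(\alpha)}\in\mathbb{R}^d$ let $$X_{k+1}^{(\alpha)}=X_k^{(\alpha)}+\alpha\bigl(-\nabla f(X_k^{(\alpha)})+w_k\bigr),\qquad Y_k^{(\alpha)}=\bigl(X_k^{(\alpha)}-x^*\bigr)/\sqrt{\alpha}.$$ (1) There exists $\bar\alpha>0$ such that for all $\alpha\in(0,\bar\alpha)$ and every initial point, $Y_k^{(\alpha)}$ converges weakly,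 as $k\to\infty$, to a random vector $Y^{(\alpha)}$, whose law does not depend on the initial point and which satisfies $\mathbb{E}[\|Y^{(\alpha)}\|_2^2]<\infty$. (2) There is a random vector $Y$ such that for every sequence $(\alpha_i)$ with $\alpha_i\in(0,\bar\alpha)$ for all $i$ and $\lim_{i\to\infty}\alpha_i=0$, $Y^{(\alpha_i)}$ converges weakly to $Y$. It satisfies $$\mathbb{E}\Bigl[\bigl(t^\top\Sigma t+2i\,t^\top H_f Y\bigr)e^{i t^\top Y}\Bigr]=0\qquad\text{for all } t\in\mathbb{R}^d$$ (the expectations being well defined). Moreover, the Lyapunov equation $H_f\Sigma_Y+\Sigma_Y H_f^\top=\Sigma$ has a unique matrix solution $\Sigma_Y$, which is positive semidefinite; and if the displayed integral equation has a unique solution in terms of the distribution of $Y$ (among all probability distributions on $\mathbb{R}^d$ for which the expectations are well defined), then $Y$ is normally distributed with mean zero and covariance matrix $\Sigma_Y$. -/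

import Mathlib

open MeasureTheory ProbabilityTheory Filter Topology Matrix

noncomputable section

namespace SGDLimit

/-- Euclidean space `ℝ^d`. -/
abbrev E (d : ℕ) : Type := EuclideanSpace ℝ (Fin d)

/-- `f` is twice differentiable on `ℝ^d`. -/
def TwiceDifferentiable {d : ℕ} (f : E d → ℝ) : Prop :=
  Differentiable ℝ f ∧ Differentiable ℝ (fderiv ℝ f)

/-- `L`-smoothness: the quadratic upper bound. -/
def IsSmooth {d : ℕ} (L : ℝ) (f : E d → ℝ) : Prop :=
  ∀ x y : E d, f y ≤ f x + inner ℝ (gradient f x) (y - x) + L / 2 * ‖x - y‖ ^ 2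

/-- `σ`-strong convexity: the quadratic lower bound. -/
def IsStronglyConvex {d : ℕ} (σ : ℝ) (f : E d → ℝ) : Prop :=
  ∀ x y : E d, f x + inner ℝ (gradient f x) (y - x) + σ / 2 * ‖x - y‖ ^ 2 ≤ f y

/-- The Hessian matrix of `f` at `x`: the entry `(i, j)` is the second derivative of `f` at `x` in
the directions of the standard basis vectors `e_i` and `e_j`. -/
def hessianMatrix {d : ℕ} (f : E d → ℝ) (x : E d) : Matrix (Fin d) (Fin d) ℝ :=
  Matrix.of fun i j =>
    fderiv ℝ (fderiv ℝ f) x (EuclideanSpace.single i 1) (EuclideanSpace.single j 1)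

/-- `w` is an i.i.d. sequence of square-integrable random vectors with mean zero and positive
definite covariance matrix `S`. -/
structure IsNoise {d : ℕ} {Ω : Type*} [MeasurableSpace Ω] (P : Measure Ω) (w : ℕ → Ω → E d)
    (S : Matrix (Fin d) (Fin d) ℝ) : Prop where
  indep : iIndepFun w P
  identDistrib : ∀ k, IdentDistrib (w k) (w 0) P P
  memLp : MemLp (w 0) 2 P
  mean_zero : ∫ ω, w 0 ω ∂P = 0
  covariance_eq : ∀ i j, covariance (fun ω => w 0 ω i) (fun ω => w 0 ω j) P = S i j
  posDef : S.PosDef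

/-- The SGD iterates `X_{k+1} = X_k + α (-∇f(X_k) + w_k)` started at `x₀`. -/
def sgd {d : ℕ} {Ω : Type*} (f : E d → ℝ) (w : ℕ → Ω → E d) (α : ℝ) (x₀ : E d) :
    ℕ → Ω → E d
  | 0 => fun _ => x₀
  | k + 1 => fun ω =>
      sgd f w α x₀ k ω + α • (-gradient f (sgd f w α x₀ k ω) + w k ω)

/-- The centered scaled iterates `Y_k = (X_k - x⋆) / √α`. -/
def scaledSgd {d : ℕ} {Ω : Type*} (f : E d → ℝ) (w : ℕ → Ω → E d) (xs : E d) (α : ℝ)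
    (x₀ : E d) (k : ℕ) (ω : Ω) : E d :=
  (√α)⁻¹ • (sgd f w α x₀ k ω - xs)

/-- The function `y ↦ (tᵀ S t + 2 i tᵀ H y) exp(i tᵀ y)`. -/
def integrand {d : ℕ} (S H : Matrix (Fin d) (Fin d) ℝ) (t y : E d) : ℂ :=
  (((t.ofLp ⬝ᵥ S *ᵥ t.ofLp : ℝ) : ℂ) + 2 * Complex.I * ((t.ofLp ⬝ᵥ H *ᵥ y.ofLp : ℝ) : ℂ)) *
    Complex.exp (Complex.I * ((t.ofLp ⬝ᵥ y.ofLp : ℝ) : ℂ))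

/-- The law `μ` of `Y` solves `E[(tᵀ S t + 2 i tᵀ H Y) exp(i tᵀ Y)] = 0` for all `t`, where the
expectations are required to exist. -/
def SolvesEquation {d : ℕ} (S H : Matrix (Fin d) (Fin d) ℝ) (μ : ProbabilityMeasure (E d)) :
    Prop :=
  ∀ t : E d, Integrable (integrand S H t) (μ : Measure (E d)) ∧
    ∫ y, integrand S H t y ∂(μ : Measure (E d)) = 0

end SGDLimit

end

/-!
In the coordinate `y = (x - x⋆) / √α` stochastic gradient descent is the recursion
`Y_{k+1} = T Y_k + √α w_k` (`scaledSgd_eq_arIter`), where `T` (`scaledStep`) fixes `0` and, by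
cocoercivity of the gradient, is Lipschitz with constant `1 - ασ/2` for small `α`
(`lipschitzWith_scaledStep`).

**Fixed stepsize.** Feeding the noise in reversed order does not change the law of `Y_k`, and the
reversed chain is Cauchy in `L²`, because one more step only moves the initial point of a
`k`-fold composition of contractions. Its limit gives the limit law and the second moment, and two
chains driven by the same noise merge geometrically, so that the initial point is irrelevant
(`exists_limit_law`).

**Vanishing stepsize.** The limit is identified directly as the centered Gaussian law whose
covariance matrix `K` solves the Lyapunov equation `HK + KH = S`, with characteristic function `g`.
Conditioning on the last step, the characteristic function `φ_k` of `Y_k` satisfies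
`φ_{k+1}(t) = E[exp(i⟨T Y_k, t⟩)] φ_w(√α t)`. Replacing `T` by its linearization `1 - αH` costs
`o(α) ‖t‖`, as the second moments of `Y_k` are bounded uniformly in `k` and `α`
(`integral_sq_norm_arIter_le`, `eventually_integral_norm_scaledStep_sub_le`); and by the Lyapunov
equation together with the second-order expansion of `φ_w` the Gaussian satisfies
`g(t) = g(t - αHt) φ_w(√α t) + o(α) ‖t‖` (`eventually_norm_gaussian_step_le`). As `1 - αH` has norm
at most `1 - ασ/2`, the accumulated errors form a geometric series of size `o(α) / (ασ/2) = o(1)`,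
uniformly in `k` (`norm_charFun_arIter_sub_le`). Letting `k → ∞` and then `α → 0`, Lévy's
convergence theorem gives the weak limit. The integral equation for the Gaussian law is the
derivative of `g` at `t` in the direction `Ht`.

The Lyapunov equation is uniquely solvable because `tr (Tᵀ(HT + TH))` is a sum of two nonnegative
terms that vanishes only for `T = 0`.
-/

namespace SGDLimit

open scoped RealInnerProductSpace NNReal ENNReal

section GradientStep

variable {d : ℕ} {f : E d → ℝ} {L σ α : ℝ}

/-! ### Contraction of gradient steps and existence of the minimizer -/

theorem IsSmooth.mono {L' : ℝ} (hf : IsSmooth L f) (h : L ≤ L') : IsSmooth L' f := by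
  intro x y
  have := hf x y
  have h2 : L / 2 * ‖x - y‖ ^ 2 ≤ L' / 2 * ‖x - y‖ ^ 2 := by gcongr
  linarith

theorem IsStronglyConvex.mul_sq_norm_sub_le (hf : IsStronglyConvex σ f) (x y : E d) :
    σ * ‖x - y‖ ^ 2 ≤ ⟪gradient f x - gradient f y, x - y⟫ := by
  have h1 := hf x y
  have h2 := hf y x
  rw [norm_sub_rev y x] at h2
  have h3 : ⟪gradient f x, y - x⟫ = -⟪gradient f x, x - y⟫ := by
    rw [← inner_neg_right, neg_sub]
  rw [inner_sub_left]
  linarith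

theorem IsStronglyConvex.sub_add_inner_le (hσ : 0 ≤ σ) (hL : 0 < L) (hc : IsStronglyConvex σ f)
    (hs : IsSmooth L f) (x y : E d) :
    f x - f y + ⟪gradient f x, y - x⟫ + (2 * L)⁻¹ * ‖gradient f x - gradient f y‖ ^ 2 ≤ 0 := by
  -- `z` minimizes the quadratic upper bound at `y` minus the tangent plane at `x`.
  set g := gradient f x - gradient f y with hg
  set z := y + L⁻¹ • g with hz
  have h1 := hc x z
  have h2 := hs y z
  have h3 : 0 ≤ σ / 2 * ‖x - z‖ ^ 2 := by positivity
  have e1 : ⟪gradient f x, z - x⟫ = ⟪gradient f x, y - x⟫ + L⁻¹ * ⟪gradient f x, g⟫ := by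
    rw [← real_inner_smul_right, ← inner_add_right, hz]
    congr 1
    abel
  have e2 : ⟪gradient f y, z - y⟫ = L⁻¹ * ⟪gradient f y, g⟫ := by
    rw [← real_inner_smul_right, hz]; congr 1; abel
  have e3 : ‖y - z‖ ^ 2 = (L⁻¹) ^ 2 * ‖g‖ ^ 2 := by
    rw [hz, sub_add_cancel_left, norm_neg, norm_smul, mul_pow, Real.norm_eq_abs, sq_abs]
  have e4 : L⁻¹ * ⟪gradient f x, g⟫ - L⁻¹ * ⟪gradient f y, g⟫ = L⁻¹ * ‖g‖ ^ 2 := by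
    rw [← mul_sub, ← inner_sub_left, ← hg, real_inner_self_eq_norm_sq]
  rw [e1] at h1
  rw [e2, e3] at h2
  have e5 : L / 2 * ((L⁻¹) ^ 2 * ‖g‖ ^ 2) = L⁻¹ * ‖g‖ ^ 2 - (2 * L)⁻¹ * ‖g‖ ^ 2 := by
    field_simp; ring
  rw [e5] at h2
  linarith

/-- Cocoercivity of the gradient of a smooth convex function. -/
theorem IsStronglyConvex.sq_norm_gradient_sub_le (hσ : 0 ≤ σ) (hL : 0 < L)
    (hc : IsStronglyConvex σ f) (hs : IsSmooth L f) (x y : E d) :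
    ‖gradient f x - gradient f y‖ ^ 2 ≤ L * ⟪gradient f x - gradient f y, x - y⟫ := by
  have h1 := hc.sub_add_inner_le hσ hL hs x y
  have h2 := hc.sub_add_inner_le hσ hL hs y x
  rw [norm_sub_rev (gradient f y)] at h2
  have h3 : ⟪gradient f x, y - x⟫ = -⟪gradient f x, x - y⟫ := by
    rw [← inner_neg_right, neg_sub]
  rw [inner_sub_left]
  have h4 : 2 * ((2 * L)⁻¹ * ‖gradient f x - gradient f y‖ ^ 2) ≤
      ⟪gradient f x, x - y⟫ - ⟪gradient f y, x - y⟫ := by linarith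
  have h5 : ‖gradient f x - gradient f y‖ ^ 2 =
      L * (2 * ((2 * L)⁻¹ * ‖gradient f x - gradient f y‖ ^ 2)) := by field_simp
  rw [h5]
  gcongr

/-- One step of gradient descent. -/
noncomputable def gradStep (f : E d → ℝ) (α : ℝ) (x : E d) : E d := x - α • gradient f x

/-- A gradient step with stepsize at most `1 / L` is a contraction. -/
theorem norm_gradStep_sub_le (hσ : 0 < σ) (hL : 0 < L) (hc : IsStronglyConvex σ f)
    (hs : IsSmooth L f) (hα : 0 < α) (hαL : α * L ≤ 1) (hασ : α * σ ≤ 1) (x y : E d) :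
    ‖gradStep f α x - gradStep f α y‖ ≤ (1 - α * σ / 2) * ‖x - y‖ := by
  refine le_of_sq_le_sq ?_ (mul_nonneg (by linarith) (norm_nonneg _))
  have e : gradStep f α x - gradStep f α y =
      (x - y) - α • (gradient f x - gradient f y) := by
    simp only [gradStep, smul_sub]; abel
  have h1 := hc.sq_norm_gradient_sub_le hσ.le hL hs x y
  have h2 := hc.mul_sq_norm_sub_le x y
  rw [e, norm_sub_sq_real, real_inner_smul_right, norm_smul, mul_pow, Real.norm_eq_abs, sq_abs,
    real_inner_comm]
  set I := ⟪gradient f x - gradient f y, x - y⟫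
  have h0 : 0 ≤ I := le_trans (by positivity) h2
  have h3 : α ^ 2 * ‖gradient f x - gradient f y‖ ^ 2 ≤ α * I := by
    calc _ ≤ α ^ 2 * (L * I) := by gcongr
      _ = α * ((α * L) * I) := by ring
      _ ≤ α * (1 * I) := by gcongr
      _ = α * I := by ring
  have h4 : α * (σ * ‖x - y‖ ^ 2) ≤ α * I := by gcongr
  nlinarith [mul_nonneg (sq_nonneg (α * σ)) (sq_nonneg ‖x - y‖)]

theorem lipschitzWith_gradStep (hσ : 0 < σ) (hL : 0 < L) (hc : IsStronglyConvex σ f)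
    (hs : IsSmooth L f) (hα : 0 < α) (hαL : α * L ≤ 1) (hασ : α * σ ≤ 1) :
    LipschitzWith (1 - α * σ / 2).toNNReal (gradStep f α) := by
  refine LipschitzWith.of_dist_le_mul fun x y => ?_
  rw [dist_eq_norm, dist_eq_norm, Real.coe_toNNReal _ (by linarith)]
  exact norm_gradStep_sub_le hσ hL hc hs hα hαL hασ x y

theorem gradient_eq_zero_of_forall_le {xs : E d} (h : ∀ x, f xs ≤ f x) : gradient f xs = 0 := by
  have : IsLocalMin f xs := Filter.Eventually.of_forall h
  simp [gradient, this.fderiv_eq_zero]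

theorem exists_stepsize (hσ : 0 < σ) (hL : 0 < L) :
    ∃ α : ℝ, 0 < α ∧ α * L ≤ 1 ∧ α * σ ≤ 1 := by
  refine ⟨(L + σ)⁻¹, by positivity, ?_, ?_⟩ <;>
  · rw [inv_mul_le_iff₀ (by positivity)]; linarith

theorem existsUnique_forall_le (hσ : 0 < σ) (hL : 0 < L) (hc : IsStronglyConvex σ f)
    (hs : IsSmooth L f) : ∃! xs : E d, ∀ x, f xs ≤ f x := by
  -- The minimizer is the fixed point of a contracting gradient step.
  obtain ⟨α, hα, hαL, hασ⟩ := exists_stepsize hσ hL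
  have hK : ContractingWith (1 - α * σ / 2).toNNReal (gradStep f α) := by
    refine ⟨?_, lipschitzWith_gradStep hσ hL hc hs hα hαL hασ⟩
    rw [← NNReal.coe_lt_coe, Real.coe_toNNReal _ (by linarith)]
    have : 0 < α * σ := by positivity
    simp only [NNReal.coe_one]; linarith
  set xs := ContractingWith.fixedPoint (gradStep f α) hK
  have hfix : gradStep f α xs = xs := hK.fixedPoint_isFixedPt
  have hg : gradient f xs = 0 := by
    have : α • gradient f xs = 0 := by
      rw [gradStep, sub_eq_self] at hfix; exact hfix
    exact (smul_eq_zero.mp this).resolve_left hα.ne'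
  refine ⟨xs, fun x => ?_, fun y hy => ?_⟩
  · have := hc xs x
    rw [hg, inner_zero_left] at this
    have h3 : 0 ≤ σ / 2 * ‖xs - x‖ ^ 2 := by positivity
    linarith
  · have := hc.mul_sq_norm_sub_le y xs
    rw [hg, gradient_eq_zero_of_forall_le hy, sub_zero, inner_zero_left] at this
    have h2 : ‖y - xs‖ ^ 2 ≤ 0 := by
      by_contra h
      push Not at h
      have := mul_pos hσ h
      linarith
    have h3 : ‖y - xs‖ = 0 := by nlinarith [norm_nonneg (y - xs)]
    exact sub_eq_zero.mp (norm_eq_zero.mp h3)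

/-! ### The Hessian and the scaled gradient step -/

/-- The Hessian of `f` at `x` as an operator: the derivative of the gradient. -/
noncomputable def hessianCLM (f : E d → ℝ) (x : E d) : E d →L[ℝ] E d :=
  (InnerProductSpace.toDual ℝ (E d)).symm.toContinuousLinearEquiv.toContinuousLinearMap ∘L
    fderiv ℝ (fderiv ℝ f) x

theorem hasFDerivAt_gradient (hf : TwiceDifferentiable f) (x : E d) :
    HasFDerivAt (gradient f) (hessianCLM f x) x :=
  ((InnerProductSpace.toDual ℝ (E d)).symm.toContinuousLinearEquiv.toContinuousLinearMap
    |>.hasFDerivAt).comp x (hf.2 x).hasFDerivAt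

theorem inner_hessianCLM (f : E d → ℝ) (x u v : E d) :
    ⟪hessianCLM f x u, v⟫ = fderiv ℝ (fderiv ℝ f) x u v := by
  simp [hessianCLM]

theorem hessianCLM_symm (hf : TwiceDifferentiable f) (x u v : E d) :
    ⟪hessianCLM f x u, v⟫ = ⟪u, hessianCLM f x v⟫ := by
  rw [real_inner_comm (hessianCLM f x v) u, inner_hessianCLM, inner_hessianCLM]
  exact second_derivative_symmetric (fun y => (hf.1 y).hasFDerivAt) (hf.2 x).hasFDerivAt u v

theorem dotProduct_hessianMatrix_mulVec (f : E d → ℝ) (x u v : E d) :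
    u.ofLp ⬝ᵥ hessianMatrix f x *ᵥ v.ofLp = ⟪hessianCLM f x u, v⟫ := by
  rw [inner_hessianCLM]
  have hu (u : E d) : u = ∑ i, u i • EuclideanSpace.single i (1 : ℝ) := by
    ext j; simp [Finset.sum_apply, Pi.single_apply]
  conv_rhs => rw [hu u, hu v]
  simp only [dotProduct, mulVec, hessianMatrix, of_apply, map_sum, map_smul,
    _root_.sum_apply, _root_.smul_apply, smul_eq_mul, Finset.mul_sum]
  rw [Finset.sum_comm]
  refine Finset.sum_congr rfl fun i _ => Finset.sum_congr rfl fun j _ => by ring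

theorem hessianMatrix_transpose (hf : TwiceDifferentiable f) (x : E d) :
    (hessianMatrix f x)ᵀ = hessianMatrix f x := by
  ext i j
  simp only [transpose_apply, hessianMatrix, of_apply]
  exact second_derivative_symmetric (fun y => (hf.1 y).hasFDerivAt) (hf.2 x).hasFDerivAt _ _

/-- The gradient step in the coordinate `y = (x - x⋆) / √α`. -/
noncomputable def scaledStep (f : E d → ℝ) (xs : E d) (α : ℝ) (y : E d) : E d :=
  (√α)⁻¹ • (gradStep f α (xs + √α • y) - xs)

theorem scaledStep_zero {xs : E d} (hg : gradient f xs = 0) : scaledStep f xs α 0 = 0 := by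
  simp [scaledStep, gradStep, hg]

theorem lipschitzWith_scaledStep (hσ : 0 < σ) (hL : 0 < L) (hc : IsStronglyConvex σ f)
    (hs : IsSmooth L f) (hα : 0 < α) (hαL : α * L ≤ 1) (hασ : α * σ ≤ 1) (xs : E d) :
    LipschitzWith (1 - α * σ / 2).toNNReal (scaledStep f xs α) := by
  refine LipschitzWith.of_dist_le_mul fun x y => ?_
  have hq : 0 < √α := Real.sqrt_pos.mpr hα
  have := norm_gradStep_sub_le hσ hL hc hs hα hαL hασ (xs + √α • x) (xs + √α • y)
  rw [dist_eq_norm, dist_eq_norm, Real.coe_toNNReal _ (by linarith), scaledStep, scaledStep,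
    ← smul_sub, sub_sub_sub_cancel_right, norm_smul, norm_inv, Real.norm_of_nonneg hq.le,
    inv_mul_le_iff₀ hq]
  refine this.trans_eq ?_
  rw [add_sub_add_left_eq_sub, ← smul_sub, norm_smul, Real.norm_of_nonneg hq.le]
  ring

theorem scaledStep_sub (hα : 0 < α) (xs y : E d) :
    scaledStep f xs α y - (y - α • hessianCLM f xs y) =
      -(α • (√α)⁻¹ • (gradient f (xs + √α • y) - hessianCLM f xs (√α • y))) := by
  have hq : √α ≠ 0 := (Real.sqrt_pos.mpr hα).ne'
  simp only [scaledStep, gradStep, smul_sub, smul_add, map_smul, smul_smul, inv_mul_cancel₀ hq,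
    one_smul]
  rw [mul_comm α]
  abel

theorem hasFDerivAt_scaledStep (hf : TwiceDifferentiable f) (hα : 0 < α) (xs : E d) :
    HasFDerivAt (scaledStep f xs α) (ContinuousLinearMap.id ℝ (E d) - α • hessianCLM f xs) 0 := by
  have hq : √α ≠ 0 := (Real.sqrt_pos.mpr hα).ne'
  have h1 : HasFDerivAt (fun y : E d => xs + √α • y) (√α • ContinuousLinearMap.id ℝ (E d)) 0 :=
    ((hasFDerivAt_id (0 : E d)).const_smul (√α)).const_add xs
  have h2 : HasFDerivAt (gradStep f α)
      (ContinuousLinearMap.id ℝ (E d) - α • hessianCLM f xs) (xs + √α • (0 : E d)) := by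
    rw [smul_zero, add_zero]
    exact (hasFDerivAt_id xs).sub ((hasFDerivAt_gradient hf xs).const_smul α)
  have h3 := ((h2.comp (0 : E d) h1).sub_const xs).const_smul (√α)⁻¹
  refine h3.congr_fderiv ?_
  ext y : 1
  simp [smul_smul, inv_mul_cancel₀ hq, inv_mul_cancel_left₀ hq, smul_sub]

theorem norm_sub_smul_hessianCLM_le (hσ : 0 < σ) (hL : 0 < L) (hc : IsStronglyConvex σ f)
    (hs : IsSmooth L f) (hf : TwiceDifferentiable f) (hα : 0 < α) (hαL : α * L ≤ 1)
    (hασ : α * σ ≤ 1) (xs v : E d) :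
    ‖v - α • hessianCLM f xs v‖ ≤ (1 - α * σ / 2) * ‖v‖ := by
  have h := (hasFDerivAt_scaledStep hf hα xs).le_of_lipschitz
    (lipschitzWith_scaledStep hσ hL hc hs hα hαL hασ xs)
  rw [Real.coe_toNNReal _ (by linarith)] at h
  simpa using (ContinuousLinearMap.id ℝ (E d) - α • hessianCLM f xs).le_of_opNorm_le h v

theorem inner_hessianCLM_pos (hσ : 0 < σ) (hL : 0 < L) (hc : IsStronglyConvex σ f)
    (hs : IsSmooth L f) (hf : TwiceDifferentiable f) (xs : E d) {v : E d} (hv : v ≠ 0) :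
    0 < ⟪hessianCLM f xs v, v⟫ := by
  obtain ⟨α, hα, hαL, hασ⟩ := exists_stepsize hσ hL
  have h1 := norm_sub_smul_hessianCLM_le hσ hL hc hs hf hα hαL hασ xs v
  have h2 := real_inner_le_norm (v - α • hessianCLM f xs v) v
  rw [inner_sub_left, real_inner_smul_left, real_inner_self_eq_norm_sq] at h2
  have hv' : 0 < ‖v‖ := norm_pos_iff.mpr hv
  have h3 := mul_le_mul_of_nonneg_right h1 hv'.le
  have h4 : 0 < α * σ / 2 * ‖v‖ ^ 2 := by positivity
  have h5 : 0 < α * ⟪hessianCLM f xs v, v⟫ := by nlinarith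
  exact (mul_pos_iff_of_pos_left hα).mp h5

end GradientStep

/-! ### Contracting recursions driven by an input sequence -/

section Recursion

variable {V : Type*} [NormedAddCommGroup V] {T : V → V} {q : ℝ≥0}

/-- The state after `k` steps of the recursion `y_{j+1} = T y_j + u_j` started at `y₀`, as a
function of the input sequence `u`. -/
def arIter (T : V → V) (y₀ : V) : ℕ → (ℕ → V) → V
  | 0, _ => y₀
  | k + 1, u => T (arIter T y₀ k u) + u k

theorem arIter_congr {y₀ : V} {k : ℕ} {u v : ℕ → V} (h : ∀ i < k, u i = v i) :
    arIter T y₀ k u = arIter T y₀ k v := by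
  induction k with
  | zero => rfl
  | succ k ih =>
    rw [arIter, arIter, ih fun i hi => h i (by omega), h k (by omega)]

theorem arIter_succ' (T : V → V) (y₀ : V) (k : ℕ) (u : ℕ → V) :
    arIter T y₀ (k + 1) u = arIter T (T y₀ + u 0) k fun i => u (i + 1) := by
  induction k with
  | zero => rfl
  | succ k ih => rw [arIter, ih, arIter]

theorem norm_arIter_sub_le (hT : LipschitzWith q T) (y₀ z₀ : V) (k : ℕ) (u : ℕ → V) :
    ‖arIter T y₀ k u - arIter T z₀ k u‖ ≤ q ^ k * ‖y₀ - z₀‖ := by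
  induction k with
  | zero => simp [arIter]
  | succ k ih =>
    rw [arIter, arIter, add_sub_add_right_eq_sub]
    calc _ ≤ q * ‖arIter T y₀ k u - arIter T z₀ k u‖ := hT.norm_sub_le _ _
      _ ≤ q * (q ^ k * ‖y₀ - z₀‖) := by gcongr
      _ = _ := by ring

/-- The permutation of `ℕ` that reverses `{0, …, k - 1}` and fixes all other numbers. -/
def revBelow (k i : ℕ) : ℕ := if i < k then k - 1 - i else i

theorem revBelow_injective (k : ℕ) : Function.Injective (revBelow k) := by
  intro i j h
  simp only [revBelow] at h
  split_ifs at h <;> omega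

/-- Feeding the inputs in reversed order turns one more step of the recursion into a change of the
initial point, so that consecutive states of the reversed recursion are geometrically close. -/
theorem norm_arIter_revBelow_sub_le (hT : LipschitzWith q T) (hT0 : T 0 = 0) (k : ℕ)
    (u : ℕ → V) :
    ‖arIter T 0 k (fun i => u (revBelow k i)) -
      arIter T 0 (k + 1) (fun i => u (revBelow (k + 1) i))‖ ≤ q ^ k * ‖u k‖ := by
  have h : arIter T 0 (k + 1) (fun i => u (revBelow (k + 1) i)) =
      arIter T (u k) k (fun i => u (revBelow k i)) := by
    rw [arIter_succ', hT0, zero_add]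
    have h0 : revBelow (k + 1) 0 = k := by simp [revBelow]
    rw [h0]
    refine arIter_congr fun i hi => ?_
    congr 1
    simp only [revBelow]
    split_ifs <;> omega
  rw [h]
  simpa using norm_arIter_sub_le hT 0 (u k) k fun i => u (revBelow k i)

variable [MeasurableSpace V] [BorelSpace V] [SecondCountableTopology V]

theorem measurable_arIter (hT : Measurable T) (y₀ : V) (k : ℕ) : Measurable (arIter T y₀ k) := by
  induction k with
  | zero => exact measurable_const
  | succ k ih => exact (hT.comp ih).add (measurable_pi_apply k)

end Recursion

/-! ### Limit laws of contracting recursions with i.i.d. noise -/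

section RandomRecursion

variable {Ω : Type*} [MeasurableSpace Ω] {P : Measure Ω}

/-- The law of an i.i.d. sequence is invariant under injective reindexing. -/
theorem identDistrib_reindex {S : Type*} [MeasurableSpace S] {ξ : ℕ → Ω → S}
    (hi : iIndepFun ξ P) (hd : ∀ k, IdentDistrib (ξ k) (ξ 0) P P)
    {g : ℕ → ℕ} (hg : Function.Injective g) :
    IdentDistrib (fun ω i => ξ (g i) ω) (fun ω i => ξ i ω) P P where
  aemeasurable_fst := aemeasurable_pi_iff.2 fun i => (hd (g i)).aemeasurable_fst
  aemeasurable_snd := aemeasurable_pi_iff.2 fun i => (hd i).aemeasurable_fst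
  map_eq := by
    rw [hi.map_fun_eq_infinitePi_map₀' fun i => (hd i).aemeasurable_fst,
      (hi.precomp hg).map_fun_eq_infinitePi_map₀' fun i => (hd (g i)).aemeasurable_fst]
    simp_rw [(hd _).map_eq]

variable {V : Type*} [NormedAddCommGroup V] [MeasurableSpace V] [BorelSpace V]
  {T : V → V} {q : ℝ≥0} {ξ : ℕ → Ω → V}

theorem aemeasurable_arIter [SecondCountableTopology V] (hT : Measurable T)
    (hd : ∀ k, IdentDistrib (ξ k) (ξ 0) P P)
    (y₀ : V) (k : ℕ) : AEMeasurable (fun ω => arIter T y₀ k fun i => ξ i ω) P :=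
  (measurable_arIter hT y₀ k).comp_aemeasurable
    (aemeasurable_pi_iff.2 fun i => (hd i).aemeasurable_fst)

theorem indepFun_arIter [SecondCountableTopology V] [IsProbabilityMeasure P]
    (hT : Measurable T) (hi : iIndepFun ξ P)
    (hd : ∀ k, IdentDistrib (ξ k) (ξ 0) P P) (y₀ : V) (k : ℕ) :
    IndepFun (fun ω => arIter T y₀ k fun i => ξ i ω) (ξ k) P := by
  classical
  have h := hi.indepFun_finset₀ (Finset.range k) {k} (by simp)
    fun i => (hd i).aemeasurable_fst
  let ext : (Finset.range k → V) → ℕ → V := fun v i =>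
    if hi : i ∈ Finset.range k then v ⟨i, hi⟩ else 0
  have hext : Measurable ext := by
    refine measurable_pi_lambda _ fun i => ?_
    by_cases hi : i ∈ Finset.range k
    · simpa only [ext, hi, dif_pos] using measurable_pi_apply (⟨i, hi⟩ : Finset.range k)
    · simpa only [ext, hi, dif_neg, not_false_eq_true] using measurable_const
  have h2 := h.comp ((measurable_arIter hT y₀ k).comp hext)
    (measurable_pi_apply (⟨k, by simp⟩ : ({k} : Finset ℕ)))
  convert! h2 using 1
  ext ω
  refine arIter_congr fun i hi => ?_
  simp [ext, hi]

theorem memLp_arIter [IsProbabilityMeasure P] (hT : LipschitzWith q T) (hT0 : T 0 = 0)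
    (hd : ∀ k, IdentDistrib (ξ k) (ξ 0) P P) (h2 : MemLp (ξ 0) 2 P) (k : ℕ) :
    MemLp (fun ω => arIter T 0 k fun i => ξ i ω) 2 P := by
  induction k with
  | zero => exact memLp_const 0
  | succ k ih => exact (hT.comp_memLp hT0 ih).add ((hd k).memLp_iff.2 h2)

/-- The second moments of the chain started at the fixed point stay below any `M` that is
compatible with one step of the recursion. -/
theorem integral_sq_norm_arIter_le [SecondCountableTopology V] [IsProbabilityMeasure P]
    [InnerProductSpace ℝ V] [CompleteSpace V]
    (hT : LipschitzWith q T) (hT0 : T 0 = 0) (hi : iIndepFun ξ P)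
    (hd : ∀ k, IdentDistrib (ξ k) (ξ 0) P P) (h2 : MemLp (ξ 0) 2 P)
    (h0 : ∫ ω, ξ 0 ω ∂P = 0) {M : ℝ} (hM : 0 ≤ M)
    (hqM : (q : ℝ) ^ 2 * M + ∫ ω, ‖ξ 0 ω‖ ^ 2 ∂P ≤ M) (k : ℕ) :
    ∫ ω, ‖arIter T 0 k fun i => ξ i ω‖ ^ 2 ∂P ≤ M := by
  induction k with
  | zero => simpa [arIter] using hM
  | succ k ih =>
    set Y : Ω → V := fun ω => arIter T 0 k fun i => ξ i ω with hY
    have hYm : MemLp Y 2 P := memLp_arIter hT hT0 hd h2 k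
    have hTY : MemLp (T ∘ Y) 2 P := hT.comp_memLp hT0 hYm
    have hξ : MemLp (ξ k) 2 P := (hd k).memLp_iff.2 h2
    have hind : IndepFun (T ∘ Y) (ξ k) P :=
      (indepFun_arIter hT.continuous.measurable hi hd 0 k).comp hT.continuous.measurable
        measurable_id
    have hc0 : ∫ ω, ⟪T (Y ω), ξ k ω⟫ ∂P = 0 := by
      have := hind.integral_bilin (hTY.integrable one_le_two) (hξ.integrable one_le_two)
        (innerSL ℝ)
      rw [(hd k).integral_eq, h0, map_zero] at this
      exact this
    have hint : Integrable (fun ω => ⟪T (Y ω), ξ k ω⟫) P :=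
      hind.integrable_bilin (hTY.integrable one_le_two) (hξ.integrable one_le_two) (innerSL ℝ)
    have e : ∀ ω, ‖arIter T 0 (k + 1) fun i => ξ i ω‖ ^ 2 =
        ‖T (Y ω)‖ ^ 2 + 2 * ⟪T (Y ω), ξ k ω⟫ + ‖ξ k ω‖ ^ 2 := fun ω => norm_add_sq_real _ _
    simp_rw [e]
    have i1 : Integrable (fun ω => ‖T (Y ω)‖ ^ 2) P := hTY.integrable_norm_pow two_ne_zero
    have i2 : Integrable (fun ω => ‖ξ k ω‖ ^ 2) P := hξ.integrable_norm_pow two_ne_zero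
    have i3 : Integrable (fun ω => ‖Y ω‖ ^ 2) P := hYm.integrable_norm_pow two_ne_zero
    rw [integral_add (by exact i1.add (hint.const_mul 2)) i2, integral_add i1 (hint.const_mul 2),
      integral_const_mul, hc0, mul_zero, add_zero]
    have e2 : ∫ ω, ‖ξ k ω‖ ^ 2 ∂P = ∫ ω, ‖ξ 0 ω‖ ^ 2 ∂P :=
      ((hd k).comp (measurable_norm.pow_const 2)).integral_eq
    have e3 : ∫ ω, ‖T (Y ω)‖ ^ 2 ∂P ≤ (q : ℝ) ^ 2 * ∫ ω, ‖Y ω‖ ^ 2 ∂P := by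
      rw [← integral_const_mul]
      refine integral_mono i1 (i3.const_mul _) fun ω => ?_
      have : ‖T (Y ω)‖ ≤ q * ‖Y ω‖ := by
        simpa [hT0] using hT.norm_sub_le (Y ω) 0
      calc ‖T (Y ω)‖ ^ 2 ≤ (q * ‖Y ω‖) ^ 2 := by gcongr
        _ = _ := mul_pow _ _ _
    rw [e2]
    have e4 : (q : ℝ) ^ 2 * ∫ ω, ‖Y ω‖ ^ 2 ∂P ≤ (q : ℝ) ^ 2 * M := by gcongr
    linarith

/-- A contracting recursion driven by square-integrable i.i.d. noise has a limit law with finite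
second moment, whatever the initial point. -/
theorem exists_limit_law [SecondCountableTopology V] [IsProbabilityMeasure P] [CompleteSpace V]
    (hT : LipschitzWith q T) (hT0 : T 0 = 0) (hq : q < 1)
    (hi : iIndepFun ξ P) (hd : ∀ k, IdentDistrib (ξ k) (ξ 0) P P) (h2 : MemLp (ξ 0) 2 P) :
    ∃ μ : ProbabilityMeasure V,
      (∀ y₀, TendstoInDistribution (fun k ω => arIter T y₀ k fun i => ξ i ω) atTop (id : V → V)
        (fun _ => P) (μ : Measure V)) ∧
      ∫⁻ y, ‖y‖ₑ ^ 2 ∂(μ : Measure V) < ⊤ := by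
  have hTm := hT.continuous.measurable
  -- The chain with time-reversed inputs has the same one-dimensional laws and converges in `L²`.
  set Z : ℕ → Ω → V := fun k ω => arIter T 0 k fun i => ξ (revBelow k i) ω with hZ
  have hZd : ∀ k, IdentDistrib (Z k) (fun ω => arIter T 0 k fun i => ξ i ω) P P := fun k =>
    (identDistrib_reindex hi hd (revBelow_injective k)).comp (measurable_arIter hTm 0 k)
  have hZm : ∀ k, MemLp (Z k) 2 P := fun k =>
    (hZd k).memLp_iff.2 (memLp_arIter hT hT0 hd h2 k)
  have hcauchy : CauchySeq fun k => (hZm k).toLp (Z k) := by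
    refine SeminormedAddCommGroup.cauchySeq_of_le_geometric (r := q)
      (C := (eLpNorm (ξ 0) 2 P).toReal) (by exact_mod_cast hq) fun k => ?_
    rw [← MemLp.toLp_sub, Lp.norm_toLp]
    have h := eLpNorm_le_nnreal_smul_eLpNorm_of_ae_le_mul (μ := P) (f := Z k - Z (k + 1))
      (g := ξ k) (c := q ^ k) (Eventually.of_forall fun ω => by
        rw [← NNReal.coe_le_coe]
        simpa using norm_arIter_revBelow_sub_le hT hT0 k fun i => ξ i ω) 2
    rw [(hd k).eLpNorm_eq] at h
    have h3 := ENNReal.toReal_mono (by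
      rw [ENNReal.smul_def, smul_eq_mul]
      exact ENNReal.mul_ne_top ENNReal.coe_ne_top h2.2.ne) h
    refine h3.trans_eq ?_
    rw [ENNReal.smul_def, smul_eq_mul, ENNReal.toReal_mul, mul_comm]
    simp
  obtain ⟨Zlim, hlim⟩ := cauchySeq_tendsto_of_complete hcauchy
  have hZlim : MemLp Zlim 2 P := Lp.memLp Zlim
  have hmeas : TendstoInMeasure P Z atTop Zlim :=
    (tendstoInMeasure_of_tendsto_Lp hlim).congr (fun k => (hZm k).coeFn_toLp) EventuallyEq.rfl
  have hdist := hmeas.tendstoInDistribution fun k => (hZd k).aemeasurable_fst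
  have hZa : AEMeasurable Zlim P := hdist.aemeasurable_limit
  let μ : ProbabilityMeasure V := ⟨P.map Zlim, Measure.isProbabilityMeasure_map hZa⟩
  have hX : TendstoInDistribution (fun k ω => arIter T 0 k fun i => ξ i ω) atTop (id : V → V)
      (fun _ => P) (μ : Measure V) := by
    refine ⟨fun k => aemeasurable_arIter hTm hd 0 k, aemeasurable_id, ?_⟩
    have e : ∀ k, (⟨P.map (Z k),
          Measure.isProbabilityMeasure_map (hZd k).aemeasurable_fst⟩ : ProbabilityMeasure V) =
        ⟨P.map fun ω => arIter T 0 k fun i => ξ i ω,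
          Measure.isProbabilityMeasure_map (hZd k).aemeasurable_snd⟩ :=
      fun k => Subtype.ext (hZd k).map_eq
    have e' : (⟨(μ : Measure V).map id, Measure.isProbabilityMeasure_map aemeasurable_id⟩ :
        ProbabilityMeasure V) = μ := Subtype.ext Measure.map_id
    rw [e']
    exact hdist.tendsto.congr e
  refine ⟨μ, fun y₀ => ?_, ?_⟩
  · refine tendstoInDistribution_of_tendstoInMeasure_sub _ _ hX ?_
      fun k => aemeasurable_arIter hTm hd y₀ k
    refine tendstoInMeasure_of_tendsto_ae (fun k => ?_) (Eventually.of_forall fun ω => ?_)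
    · exact ((aemeasurable_arIter hTm hd y₀ k).sub
        (aemeasurable_arIter hTm hd 0 k)).aestronglyMeasurable
    · refine squeeze_zero_norm (fun k => norm_arIter_sub_le hT y₀ 0 k _) ?_
      have := (tendsto_pow_atTop_nhds_zero_of_lt_one q.coe_nonneg
        (by exact_mod_cast hq)).mul_const ‖y₀ - 0‖
      simpa using this
  · have h := hZlim.2
    rw [eLpNorm_lt_top_iff_lintegral_rpow_enorm_lt_top two_ne_zero ENNReal.ofNat_ne_top] at h
    change ∫⁻ y, ‖y‖ₑ ^ 2 ∂(P.map Zlim) < ⊤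
    rw [lintegral_map' (by fun_prop) hZa]
    simpa using h

end RandomRecursion

/-! ### Characteristic functions along the recursion -/

section CharFun

theorem norm_exp_mul_I_sub_taylor_le (x : ℝ) :
    ‖Complex.exp (x * Complex.I) - (1 + x * Complex.I - (x ^ 2 / 2 : ℝ))‖ ≤
      4 * (x ^ 2 * min 1 |x|) := by
  rcases le_total |x| 1 with h | h
  · rw [min_eq_right h]
    have h1 := Complex.norm_exp_sub_sum_le_norm_mul_exp (x * Complex.I) 3
    have e : ∑ m ∈ Finset.range 3, (x * Complex.I) ^ m / (m.factorial : ℂ) =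
        1 + x * Complex.I - (x ^ 2 / 2 : ℝ) := by
      simp [Finset.sum_range_succ, mul_pow]; ring
    rw [e] at h1
    have e2 : ‖(x : ℂ) * Complex.I‖ = |x| := by simp
    rw [e2] at h1
    refine h1.trans ?_
    have h2 : Real.exp |x| ≤ 4 :=
      (Real.exp_le_exp.mpr h).trans (by linarith [Real.exp_one_lt_d9])
    rw [← sq_abs x]
    nlinarith [pow_nonneg (abs_nonneg x) 3]
  · rw [min_eq_left h, mul_one]
    have h1 : ‖Complex.exp (x * Complex.I)‖ = 1 := Complex.norm_exp_ofReal_mul_I x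
    have h2 : ‖(1 + x * Complex.I - (x ^ 2 / 2 : ℝ) : ℂ)‖ ≤ 1 + |x| + x ^ 2 / 2 := by
      refine (norm_sub_le _ _).trans (add_le_add ((norm_add_le _ _).trans ?_) ?_)
      · simp
      · rw [Complex.norm_real, Real.norm_of_nonneg (by positivity)]
    refine (norm_sub_le _ _).trans ?_
    rw [h1, ← sq_abs x] at *
    nlinarith

theorem norm_exp_mul_I_sub_exp_mul_I_le (x y : ℝ) :
    ‖Complex.exp (x * Complex.I) - Complex.exp (y * Complex.I)‖ ≤ |x - y| := by
  have e : Complex.exp (x * Complex.I) - Complex.exp (y * Complex.I) =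
      Complex.exp (y * Complex.I) * (Complex.exp (Complex.I * (x - y : ℝ)) - 1) := by
    rw [mul_sub, ← Complex.exp_add, mul_one]
    congr 2
    push_cast; ring
  rw [e, norm_mul, Complex.norm_exp_ofReal_mul_I, one_mul]
  exact Real.norm_exp_I_mul_ofReal_sub_one_le

variable {V : Type*} [NormedAddCommGroup V] [InnerProductSpace ℝ V] [MeasurableSpace V]
  [BorelSpace V]

/-- Second-order expansion at `0` of the characteristic function of a centered square-integrable
law. -/
theorem exists_norm_charFun_sub_le [CompleteSpace V] [SecondCountableTopology V]
    {ν : Measure V} [IsProbabilityMeasure ν] (h2 : MemLp id 2 ν) (h0 : ∫ x, x ∂ν = 0) {ε : ℝ}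
    (hε : 0 < ε) :
    ∃ δ > 0, ∀ u : V, ‖u‖ < δ →
      ‖charFun ν u - (1 - (∫ x, ⟪x, u⟫ ^ 2 ∂ν) / 2 : ℝ)‖ ≤ ε * ‖u‖ ^ 2 := by
  have hsq : Integrable (fun x : V => ‖x‖ ^ 2) ν := h2.integrable_norm_pow two_ne_zero
  have hid : Integrable (fun x : V => x) ν := h2.integrable one_le_two
  have hbd : ∀ (s : ℝ) (x : V), ‖‖x‖ ^ 2 * min 1 (|s| * ‖x‖)‖ ≤ ‖x‖ ^ 2 := fun s x => by
    rw [Real.norm_of_nonneg (by positivity)]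
    exact mul_le_of_le_one_right (by positivity) (min_le_left _ _)
  have hmeas : ∀ s : ℝ, AEStronglyMeasurable (fun x : V => ‖x‖ ^ 2 * min 1 (|s| * ‖x‖)) ν :=
    fun s => by fun_prop
  have hlim : Tendsto (fun s : ℝ => ∫ x, ‖x‖ ^ 2 * min 1 (|s| * ‖x‖) ∂ν) (𝓝 0) (𝓝 0) := by
    have := tendsto_integral_filter_of_dominated_convergence (μ := ν) (l := 𝓝 (0 : ℝ))
      (F := fun (s : ℝ) (x : V) => ‖x‖ ^ 2 * min 1 (|s| * ‖x‖)) (f := fun _ => 0)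
      (fun x => ‖x‖ ^ 2) (Eventually.of_forall hmeas)
      (Eventually.of_forall fun s => Eventually.of_forall (hbd s)) hsq
      (Eventually.of_forall fun x => by
        have hc : Continuous fun s : ℝ => ‖x‖ ^ 2 * min 1 (|s| * ‖x‖) := by fun_prop
        simpa using hc.tendsto 0)
    simpa using this
  obtain ⟨δ, hδ, hδ'⟩ := Metric.tendsto_nhds_nhds.mp hlim (ε / 4) (by positivity)
  refine ⟨δ, hδ, fun u hu => ?_⟩
  have hin : Integrable (fun x : V => ⟪x, u⟫) ν := hid.inner_const u
  have hin2 : Integrable (fun x : V => ⟪x, u⟫ ^ 2) ν := by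
    refine (hsq.const_mul (‖u‖ ^ 2)).mono' (by fun_prop) (Eventually.of_forall fun x => ?_)
    rw [norm_pow, ← mul_pow, mul_comm]
    gcongr
    exact norm_inner_le_norm x u
  have he : Integrable (fun x : V => Complex.exp (⟪x, u⟫ * Complex.I)) ν := by
    refine (integrable_const (1 : ℝ)).mono' (by fun_prop) (Eventually.of_forall fun x => ?_)
    rw [Complex.norm_exp_ofReal_mul_I]
  have hi1 : ∫ x, ⟪x, u⟫ ∂ν = 0 := by
    simp_rw [real_inner_comm u]
    rw [integral_inner hid, h0, inner_zero_right]
  have hpoly : Integrable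
      (fun x : V => (1 + ⟪x, u⟫ * Complex.I - (⟪x, u⟫ ^ 2 / 2 : ℝ) : ℂ)) ν :=
    ((integrable_const _).add (hin.ofReal.mul_const _)).sub (hin2.div_const 2).ofReal
  have e1 : ∫ x, (1 + ⟪x, u⟫ * Complex.I - (⟪x, u⟫ ^ 2 / 2 : ℝ) : ℂ) ∂ν =
      (1 - (∫ x, ⟪x, u⟫ ^ 2 ∂ν) / 2 : ℝ) := by
    rw [integral_sub (by exact (integrable_const _).add (hin.ofReal.mul_const _))
      (by exact (hin2.div_const 2).ofReal), integral_add (integrable_const _)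
      (by exact hin.ofReal.mul_const _), integral_mul_const, integral_complex_ofReal,
      integral_complex_ofReal, hi1, integral_div]
    simp
  rw [charFun_apply, ← e1, ← integral_sub he hpoly]
  have hδu := hδ' (x := ‖u‖) (by simpa using hu)
  rw [dist_zero_right, Real.norm_of_nonneg (integral_nonneg fun x => by positivity)] at hδu
  have hint : Integrable (fun x : V => ‖x‖ ^ 2 * min 1 (|‖u‖| * ‖x‖)) ν :=
    hsq.mono' (hmeas _) (Eventually.of_forall (hbd _))
  calc _ ≤ ∫ x, 4 * ‖u‖ ^ 2 * (‖x‖ ^ 2 * min 1 (|‖u‖| * ‖x‖)) ∂ν := by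
        refine norm_integral_le_of_norm_le (hint.const_mul _) (Eventually.of_forall fun x => ?_)
        refine (norm_exp_mul_I_sub_taylor_le _).trans ?_
        have h3 : |⟪x, u⟫| ≤ ‖u‖ * ‖x‖ := by
          rw [mul_comm]; exact abs_real_inner_le_norm x u
        rw [← sq_abs ⟪x, u⟫, abs_norm]
        calc 4 * (|⟪x, u⟫| ^ 2 * min 1 |⟪x, u⟫|)
            ≤ 4 * ((‖u‖ * ‖x‖) ^ 2 * min 1 (‖u‖ * ‖x‖)) := by gcongr
          _ = _ := by ring
    _ = 4 * ‖u‖ ^ 2 * ∫ x, ‖x‖ ^ 2 * min 1 (|‖u‖| * ‖x‖) ∂ν := integral_const_mul _ _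
    _ ≤ 4 * ‖u‖ ^ 2 * (ε / 4) := by gcongr
    _ = ε * ‖u‖ ^ 2 := by ring

/-- Replacing a nonlinear step `T` by a symmetric linear one `A` changes the characteristic
function at `t` by at most `‖t‖` times the mean error. -/
theorem norm_charFun_map_sub_le [SecondCountableTopology V] {Ω : Type*} [MeasurableSpace Ω]
    {P : Measure Ω} [IsProbabilityMeasure P] {Y : Ω → V} (hY : AEMeasurable Y P)
    {T : V → V} (hT : Measurable T) {A : V →L[ℝ] V} (hA : ∀ x y, ⟪A x, y⟫ = ⟪x, A y⟫) {η : ℝ}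
    (hint : Integrable (fun ω => ‖T (Y ω) - A (Y ω)‖) P)
    (hη : ∫ ω, ‖T (Y ω) - A (Y ω)‖ ∂P ≤ η) (t : V) :
    ‖charFun (P.map (T ∘ Y)) t - charFun (P.map Y) (A t)‖ ≤ η * ‖t‖ := by
  have hTY : AEMeasurable (T ∘ Y) P := hT.comp_aemeasurable hY
  have hexp : ∀ {Z : Ω → V} (_ : AEMeasurable Z P) (u : V),
      Integrable (fun ω => Complex.exp (⟪Z ω, u⟫ * Complex.I)) P := fun hZ u => by
    refine (integrable_const (1 : ℝ)).mono' ?_ (Eventually.of_forall fun x => ?_)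
    · have hm : Measurable fun x : V => Complex.exp (⟪x, u⟫ * Complex.I) := by fun_prop
      exact (hm.comp_aemeasurable hZ).aestronglyMeasurable
    · rw [Complex.norm_exp_ofReal_mul_I]
  rw [charFun_apply, charFun_apply, integral_map hTY (by fun_prop), integral_map hY (by fun_prop),
    ← integral_sub (hexp hTY t) (hexp hY (A t))]
  calc _ ≤ ∫ ω, ‖T (Y ω) - A (Y ω)‖ * ‖t‖ ∂P := by
        refine norm_integral_le_of_norm_le (hint.mul_const _) (Eventually.of_forall fun ω => ?_)
        refine (norm_exp_mul_I_sub_exp_mul_I_le _ _).trans ?_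
        rw [← hA, ← inner_sub_left]
        exact abs_real_inner_le_norm _ _
    _ = (∫ ω, ‖T (Y ω) - A (Y ω)‖ ∂P) * ‖t‖ := integral_mul_const _ _
    _ ≤ η * ‖t‖ := by gcongr

/-- If `g` is nearly invariant under the linear recursion and the recursion is nearly linear in
mean, then `g` is close to the characteristic functions of the chain: the errors of the single
steps add up to a geometric series because `A` contracts. -/
theorem norm_charFun_arIter_sub_le [CompleteSpace V] [SecondCountableTopology V]
    {Ω : Type*} [MeasurableSpace Ω]
    {P : Measure Ω} [IsProbabilityMeasure P] {ξ : ℕ → Ω → V} {T : V → V} {A : V →L[ℝ] V}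
    {g : V → ℂ} {q C R η₁ η₂ : ℝ} (hT : Measurable T) (hi : iIndepFun ξ P)
    (hd : ∀ k, IdentDistrib (ξ k) (ξ 0) P P)
    (hA : ∀ x y, ⟪A x, y⟫ = ⟪x, A y⟫) (hAq : ∀ x, ‖A x‖ ≤ q * ‖x‖) (hq0 : 0 ≤ q) (hq1 : q < 1)
    (hint : ∀ k, Integrable (fun ω => ‖T (arIter T 0 k fun i => ξ i ω) -
      A (arIter T 0 k fun i => ξ i ω)‖) P)
    (hη₁ : ∀ k, ∫ ω, ‖T (arIter T 0 k fun i => ξ i ω) - A (arIter T 0 k fun i => ξ i ω)‖ ∂P ≤ η₁)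
    (hη₂ : ∀ t, ‖t‖ ≤ R → ‖g t - g (A t) * charFun (P.map (ξ 0)) t‖ ≤ η₂ * ‖t‖)
    (hη : 0 ≤ η₁ + η₂)
    (hC : 0 ≤ C) (hg : ∀ t, ‖t‖ ≤ R → ‖1 - g t‖ ≤ C * ‖t‖) (k : ℕ) {t : V} (ht : ‖t‖ ≤ R) :
    ‖charFun (P.map fun ω => arIter T 0 k fun i => ξ i ω) t - g t‖ ≤
      (C * q ^ k + (η₁ + η₂) / (1 - q)) * ‖t‖ := by
  have hq' : 0 < 1 - q := by linarith
  induction k generalizing t with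
  | zero =>
    have e : charFun (P.map fun ω => arIter T 0 0 fun i => ξ i ω) t = 1 := by
      simp [arIter, Measure.map_const]
    rw [e, pow_zero, mul_one, add_mul]
    have : 0 ≤ (η₁ + η₂) / (1 - q) * ‖t‖ := by positivity
    linarith [hg t ht]
  | succ k ih =>
    set Y : Ω → V := fun ω => arIter T 0 k fun i => ξ i ω with hY
    have hYm : AEMeasurable Y P := aemeasurable_arIter hT hd 0 k
    have hind : IndepFun (T ∘ Y) (ξ k) P :=
      (indepFun_arIter hT hi hd 0 k).comp hT measurable_id
    have e : charFun (P.map fun ω => arIter T 0 (k + 1) fun i => ξ i ω) t =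
        charFun (P.map (T ∘ Y)) t * charFun (P.map (ξ 0)) t := by
      have := hind.charFun_map_add_eq_mul (hT.comp_aemeasurable hYm) (hd k).aemeasurable_fst
      rw [(hd k).map_eq] at this
      exact congrFun this t
    have hAt : ‖A t‖ ≤ R :=
      (hAq t).trans ((mul_le_of_le_one_left (norm_nonneg t) hq1.le).trans ht)
    have hφ : ‖charFun (P.map (ξ 0)) t‖ ≤ 1 := by
      have := Measure.isProbabilityMeasure_map (μ := P) (hd 0).aemeasurable_fst
      exact norm_charFun_le_one t
    have h1 := norm_charFun_map_sub_le hYm hT hA (hint k) (hη₁ k) t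
    have h2 : ‖charFun (P.map Y) (A t) - g (A t)‖ ≤
        (C * q ^ k + (η₁ + η₂) / (1 - q)) * (q * ‖t‖) := by
      refine (ih hAt).trans ?_
      gcongr
      exact hAq t
    have h3 := hη₂ t ht
    set φ := charFun (P.map (ξ 0)) t
    have e2 : charFun (P.map (T ∘ Y)) t * φ - g t =
        (charFun (P.map (T ∘ Y)) t - charFun (P.map Y) (A t)) * φ +
        (charFun (P.map Y) (A t) - g (A t)) * φ - (g t - g (A t) * φ) := by ring
    rw [e, e2]
    have h4 : (η₁ + η₂) / (1 - q) * q + (η₁ + η₂) = (η₁ + η₂) / (1 - q) := by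
      field_simp; ring
    calc _ ≤ ‖charFun (P.map (T ∘ Y)) t - charFun (P.map Y) (A t)‖ * ‖φ‖ +
          ‖charFun (P.map Y) (A t) - g (A t)‖ * ‖φ‖ + ‖g t - g (A t) * φ‖ := by
          refine (norm_sub_le _ _).trans (add_le_add_left ((norm_add_le _ _).trans ?_) _)
          rw [norm_mul, norm_mul]
      _ ≤ η₁ * ‖t‖ + (C * q ^ k + (η₁ + η₂) / (1 - q)) * (q * ‖t‖) + η₂ * ‖t‖ := by
          exact add_le_add (add_le_add
            ((mul_le_of_le_one_right (norm_nonneg _) hφ).trans h1)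
            ((mul_le_of_le_one_right (norm_nonneg _) hφ).trans h2)) h3
      _ = (C * q ^ (k + 1) + ((η₁ + η₂) / (1 - q) * q + (η₁ + η₂))) * ‖t‖ := by ring
      _ = _ := by rw [h4]

/-- A Gaussian characteristic function whose quadratic form `Q` solves the Lyapunov equation
`Q(t) - Q(t - αHt) = α s(t) - α² Q(Ht)`, where `s` is the covariance form of the centered law `ν`,
is invariant up to `o(α)` under the linear recursion with noise `ν` scaled by `√α`. -/
theorem eventually_norm_gaussian_step_le [CompleteSpace V] [SecondCountableTopology V]
    {ν : Measure V} [IsProbabilityMeasure ν] (h2 : MemLp id 2 ν) (h0 : ∫ x, x ∂ν = 0)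
    {Q : V → ℝ} {H : V → V} {c : ℝ} (hc : 0 ≤ c) (hQ0 : ∀ t, 0 ≤ Q t)
    (hQH : ∀ t, Q (H t) ≤ c * ‖t‖ ^ 2) (hs : ∀ t, ∫ x, ⟪x, t⟫ ^ 2 ∂ν ≤ c * ‖t‖ ^ 2)
    (hQ : ∀ (α : ℝ) t, Q t - Q (t - α • H t) = α * ∫ x, ⟪x, t⟫ ^ 2 ∂ν - α ^ 2 * Q (H t))
    {R ε : ℝ} (hR : 0 < R) (hε : 0 < ε) :
    ∀ᶠ α in 𝓝[>] (0 : ℝ), ∀ t, ‖t‖ ≤ R →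
      ‖Complex.exp (-(Q t / 2 : ℝ)) -
        Complex.exp (-(Q (t - α • H t) / 2 : ℝ)) * charFun ν (√α • t)‖ ≤ α * ε * ‖t‖ := by
  obtain ⟨δ, hδ, hchar⟩ := exists_norm_charFun_sub_le h2 h0 (ε := ε / (2 * R)) (by positivity)
  have hev1 : ∀ᶠ α in 𝓝[>] (0 : ℝ), √α * R < δ := by
    have : Tendsto (fun α : ℝ => √α * R) (𝓝[>] 0) (𝓝 0) := by
      have hc : Continuous fun α : ℝ => √α * R := by fun_prop
      simpa using (hc.tendsto 0).mono_left nhdsWithin_le_nhds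
    exact this.eventually_lt_const hδ
  have hev2 : ∀ᶠ α in 𝓝[>] (0 : ℝ), α * (c ^ 2 * R ^ 3 + c * R) < ε / 2 := by
    have : Tendsto (fun α : ℝ => α * (c ^ 2 * R ^ 3 + c * R)) (𝓝[>] 0) (𝓝 0) := by
      have hc : Continuous fun α : ℝ => α * (c ^ 2 * R ^ 3 + c * R) := by fun_prop
      simpa using (hc.tendsto 0).mono_left nhdsWithin_le_nhds
    exact this.eventually_lt_const (by positivity)
  have hev3 : ∀ᶠ α in 𝓝[>] (0 : ℝ), α * (c * R ^ 2) < 1 := by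
    have : Tendsto (fun α : ℝ => α * (c * R ^ 2)) (𝓝[>] 0) (𝓝 0) := by
      have hc : Continuous fun α : ℝ => α * (c * R ^ 2) := by fun_prop
      simpa using (hc.tendsto 0).mono_left nhdsWithin_le_nhds
    exact this.eventually_lt_const one_pos
  have hev4 : ∀ᶠ α in 𝓝[>] (0 : ℝ), α < 1 :=
    (tendsto_id.mono_left nhdsWithin_le_nhds).eventually_lt_const one_pos
  filter_upwards [hev1, hev2, hev3, hev4, self_mem_nhdsWithin] with α h1 h3 h4 h5 hα t ht
  have hα : 0 < α := hα
  set s := ∫ x, ⟪x, t⟫ ^ 2 ∂ν with hs_def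
  have hs0 : 0 ≤ s := integral_nonneg fun x => sq_nonneg _
  set a := (α * s - α ^ 2 * Q (H t)) / 2 with ha
  have hct : c * ‖t‖ ^ 2 ≤ c * R ^ 2 := by gcongr
  have hQs : α ^ 2 * Q (H t) ≤ α * (α * (c * ‖t‖ ^ 2)) := by
    have := mul_le_mul_of_nonneg_left (hQH t) (sq_nonneg α)
    linarith [this, sq α]
  have hαs : α * s ≤ α * (c * ‖t‖ ^ 2) := mul_le_mul_of_nonneg_left (hs t) hα.le
  have hX : 0 ≤ α * (c * ‖t‖ ^ 2) := by positivity
  have hQ2 : α ^ 2 * Q (H t) ≤ α * (c * ‖t‖ ^ 2) :=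
    hQs.trans (mul_le_of_le_one_left hX h5.le)
  have hQ3 : 0 ≤ α ^ 2 * Q (H t) := mul_nonneg (sq_nonneg _) (hQ0 _)
  have habs : |a| ≤ α * (c * ‖t‖ ^ 2) := by
    rw [ha, abs_le]
    have := mul_nonneg hα.le hs0
    constructor <;> linarith
  have habs1 : |a| ≤ 1 := habs.trans ((mul_le_mul_of_nonneg_left hct hα.le).trans h4.le)
  -- Factor out the Gaussian at `t - αHt`, whose modulus is at most one.
  have e1 : Complex.exp (-(Q t / 2 : ℝ)) =
      Complex.exp (-(Q (t - α • H t) / 2 : ℝ)) * Complex.exp (-(a : ℝ)) := by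
    rw [← Complex.exp_add]
    congr 1
    have := hQ α t
    have e : Q t / 2 = Q (t - α • H t) / 2 + a := by rw [ha]; linarith
    rw [e]; push_cast; ring
  have hg1 : ‖Complex.exp (-(Q (t - α • H t) / 2 : ℝ))‖ ≤ 1 := by
    rw [← Complex.ofReal_neg, Complex.norm_exp_ofReal, Real.exp_le_one_iff]
    linarith [hQ0 (t - α • H t)]
  rw [e1, ← mul_sub, norm_mul]
  refine (mul_le_of_le_one_left (norm_nonneg _) hg1).trans ?_
  have hu : ‖√α • t‖ < δ := by
    rw [norm_smul, Real.norm_of_nonneg (Real.sqrt_nonneg _)]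
    exact (mul_le_mul_of_nonneg_left ht (Real.sqrt_nonneg _)).trans_lt h1
  have hφ := hchar (√α • t) hu
  have e2 : ∫ x, ⟪x, √α • t⟫ ^ 2 ∂ν = α * s := by
    simp_rw [real_inner_smul_right, mul_pow, Real.sq_sqrt hα.le]
    exact integral_const_mul _ _
  rw [e2, norm_smul, Real.norm_of_nonneg (Real.sqrt_nonneg _), mul_pow, Real.sq_sqrt hα.le] at hφ
  have hexp : ‖Complex.exp (-(a : ℝ)) - 1 - (-(a : ℝ) : ℂ)‖ ≤ |a| ^ 2 := by
    have := Complex.norm_exp_sub_one_sub_id_le (x := (-(a : ℝ) : ℂ)) (by simpa using habs1)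
    simpa using this
  have e3 : Complex.exp (-(a : ℝ)) - charFun ν (√α • t) =
      (Complex.exp (-(a : ℝ)) - 1 - (-(a : ℝ) : ℂ)) + ((α ^ 2 * Q (H t) / 2 : ℝ) : ℂ) -
        (charFun ν (√α • t) - (1 - α * s / 2 : ℝ)) := by
    rw [ha]; push_cast; ring
  have hn : 0 ≤ ‖t‖ := norm_nonneg t
  have hb1 : |a| ^ 2 ≤ α * ‖t‖ * (α * (c ^ 2 * R ^ 3)) := by
    calc |a| ^ 2 ≤ (α * (c * ‖t‖ ^ 2)) ^ 2 := by gcongr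
      _ = α * ‖t‖ * (α * (c ^ 2 * ‖t‖ ^ 3)) := by ring
      _ ≤ _ := by gcongr
  have hb2 : α ^ 2 * Q (H t) / 2 ≤ α * ‖t‖ * (α * (c * R)) := by
    calc α ^ 2 * Q (H t) / 2 ≤ α * (α * (c * ‖t‖ ^ 2)) := by linarith
      _ = α * ‖t‖ * (α * (c * ‖t‖)) := by ring
      _ ≤ _ := by gcongr
  have hb3 : ε / (2 * R) * (α * ‖t‖ ^ 2) ≤ α * ‖t‖ * (ε / 2) := by
    calc ε / (2 * R) * (α * ‖t‖ ^ 2) = α * ‖t‖ * (ε / (2 * R) * ‖t‖) := by ring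
      _ ≤ α * ‖t‖ * (ε / (2 * R) * R) := by gcongr
      _ = _ := by field_simp
  rw [e3]
  calc _ ≤ |a| ^ 2 + α ^ 2 * Q (H t) / 2 + ε / (2 * R) * (α * ‖t‖ ^ 2) := by
        refine (norm_sub_le _ _).trans (add_le_add ((norm_add_le _ _).trans ?_) hφ)
        refine add_le_add hexp ?_
        rw [Complex.norm_real, Real.norm_of_nonneg (by positivity)]
    _ ≤ α * ‖t‖ * (α * (c ^ 2 * R ^ 3)) + α * ‖t‖ * (α * (c * R)) + α * ‖t‖ * (ε / 2) := by
        gcongr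
    _ = α * ‖t‖ * (α * (c ^ 2 * R ^ 3 + c * R) + ε / 2) := by ring
    _ ≤ α * ‖t‖ * (ε / 2 + ε / 2) := by gcongr
    _ = α * ε * ‖t‖ := by ring

end CharFun

/-! ### Mean error of the linearized gradient step -/

section Linearization

variable {d : ℕ} {f : E d → ℝ} {L σ : ℝ}

theorem norm_gradient_sub_le (hσ : 0 ≤ σ) (hL : 0 < L) (hc : IsStronglyConvex σ f)
    (hs : IsSmooth L f) (x y : E d) : ‖gradient f x - gradient f y‖ ≤ L * ‖x - y‖ := by
  have h1 := hc.sq_norm_gradient_sub_le hσ hL hs x y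
  have h2 := real_inner_le_norm (gradient f x - gradient f y) (x - y)
  rcases (norm_nonneg (gradient f x - gradient f y)).eq_or_lt with h | h
  · rw [← h]; positivity
  · have h3 := mul_le_mul_of_nonneg_left h2 hL.le
    nlinarith

/-- The mean error of replacing the scaled gradient step by its linearization is `o(α)`, uniformly
over random points with bounded second moment. -/
theorem eventually_integral_norm_scaledStep_sub_le (hσ : 0 ≤ σ) (hL : 0 < L)
    (hc : IsStronglyConvex σ f) (hs : IsSmooth L f) (hf : TwiceDifferentiable f) {xs : E d}
    (hg : gradient f xs = 0) {Ω : Type*} [MeasurableSpace Ω] (P : Measure Ω)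
    [IsProbabilityMeasure P] {M ε : ℝ} (hM : 0 ≤ M) (hε : 0 < ε) :
    ∀ᶠ α in 𝓝[>] (0 : ℝ), ∀ Y : Ω → E d, MemLp Y 2 P → ∫ ω, ‖Y ω‖ ^ 2 ∂P ≤ M →
      Integrable (fun ω => ‖scaledStep f xs α (Y ω) - (Y ω - α • hessianCLM f xs (Y ω))‖) P ∧
      ∫ ω, ‖scaledStep f xs α (Y ω) - (Y ω - α • hessianCLM f xs (Y ω))‖ ∂P ≤ α * ε := by
  set H := hessianCLM f xs
  set K := L + ‖H‖ with hK
  have hK0 : 0 ≤ K := by positivity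
  -- The remainder of the linearization of the gradient is `o(‖h‖)` and at most `K‖h‖`.
  have hglob : ∀ h : E d, ‖gradient f (xs + h) - H h‖ ≤ K * ‖h‖ := fun h => by
    have h1 := norm_gradient_sub_le hσ hL hc hs (xs + h) xs
    rw [hg, sub_zero, add_sub_cancel_left] at h1
    calc _ ≤ ‖gradient f (xs + h)‖ + ‖H h‖ := norm_sub_le _ _
      _ ≤ L * ‖h‖ + ‖H‖ * ‖h‖ := add_le_add h1 (H.le_opNorm h)
      _ = _ := by rw [hK]; ring
  set ε' := ε / (2 * (1 + M)) with hε'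
  have hε'0 : 0 < ε' := by positivity
  obtain ⟨δ, hδ, hloc⟩ : ∃ δ > 0, ∀ h : E d, ‖h‖ < δ →
      ‖gradient f (xs + h) - H h‖ ≤ ε' * ‖h‖ := by
    have := (hasFDerivAt_iff_isLittleO_nhds_zero.mp (hasFDerivAt_gradient hf xs)).def hε'0
    rw [Metric.eventually_nhds_iff] at this
    obtain ⟨δ, hδ, h⟩ := this
    refine ⟨δ, hδ, fun y hy => ?_⟩
    simpa [hg] using h (y := y) (by simpa using hy)
  have hall : ∀ h : E d, ‖gradient f (xs + h) - H h‖ ≤ ε' * ‖h‖ + K / δ * ‖h‖ ^ 2 := fun h => by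
    rcases lt_or_ge ‖h‖ δ with h1 | h1
    · have : 0 ≤ K / δ * ‖h‖ ^ 2 := by positivity
      linarith [hloc h h1]
    · have h2 : K * ‖h‖ ≤ K / δ * ‖h‖ ^ 2 := by
        calc K * ‖h‖ = K / δ * (δ * ‖h‖) := by field_simp
          _ ≤ K / δ * (‖h‖ * ‖h‖) := by gcongr
          _ = _ := by ring
      have : 0 ≤ ε' * ‖h‖ := by positivity
      linarith [hglob h]
  have hev : ∀ᶠ α in 𝓝[>] (0 : ℝ), K / δ * √α * M < ε / 2 := by
    have : Tendsto (fun α : ℝ => K / δ * √α * M) (𝓝[>] 0) (𝓝 0) := by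
      have hc : Continuous fun α : ℝ => K / δ * √α * M := by fun_prop
      simpa using (hc.tendsto 0).mono_left nhdsWithin_le_nhds
    exact this.eventually_lt_const (by positivity)
  filter_upwards [hev, self_mem_nhdsWithin] with α hα1 hα Y hY hYM
  have hα : 0 < α := hα
  have hq : 0 < √α := Real.sqrt_pos.mpr hα
  have hbound : ∀ y : E d, ‖scaledStep f xs α y - (y - α • H y)‖ ≤
      α * (ε' + (ε' + K / δ * √α) * ‖y‖ ^ 2) := fun y => by
    rw [scaledStep_sub hα, norm_neg, norm_smul, norm_smul, norm_inv, Real.norm_of_nonneg hα.le,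
      Real.norm_of_nonneg hq.le]
    gcongr
    rw [inv_mul_le_iff₀ hq]
    refine (hall _).trans ?_
    rw [norm_smul, Real.norm_of_nonneg hq.le]
    have h1 : ‖y‖ ≤ 1 + ‖y‖ ^ 2 := by nlinarith [sq_nonneg (‖y‖ - 1)]
    calc ε' * (√α * ‖y‖) + K / δ * (√α * ‖y‖) ^ 2
        ≤ ε' * (√α * (1 + ‖y‖ ^ 2)) + K / δ * (√α * ‖y‖) ^ 2 := by gcongr
      _ = _ := by ring
  have hsq : Integrable (fun ω => ‖Y ω‖ ^ 2) P := hY.integrable_norm_pow two_ne_zero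
  have hdom : Integrable (fun ω => α * (ε' + (ε' + K / δ * √α) * ‖Y ω‖ ^ 2)) P :=
    ((integrable_const _).add (hsq.const_mul _)).const_mul _
  have hcont : Continuous fun y : E d => ‖scaledStep f xs α y - (y - α • H y)‖ := by
    have hgc : Continuous (gradient f) :=
      continuous_iff_continuousAt.mpr fun x => (hasFDerivAt_gradient hf x).continuousAt
    unfold scaledStep gradStep
    fun_prop
  have hint : Integrable (fun ω => ‖scaledStep f xs α (Y ω) - (Y ω - α • H (Y ω))‖) P := by
    refine hdom.mono' (hcont.comp_aestronglyMeasurable hY.1) (Eventually.of_forall fun ω => ?_)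
    rw [norm_norm]
    exact hbound _
  refine ⟨hint, (integral_mono hint hdom fun ω => hbound _).trans ?_⟩
  rw [integral_const_mul, integral_add (integrable_const _) (hsq.const_mul _),
    integral_const_mul, integral_const]
  simp only [probReal_univ, one_smul]
  gcongr
  have h1 : (ε' + K / δ * √α) * ∫ ω, ‖Y ω‖ ^ 2 ∂P ≤ (ε' + K / δ * √α) * M := by gcongr
  have h2 : ε' * (1 + M) = ε / 2 := by rw [hε']; field_simp
  nlinarith

end Linearization

/-! ### The Lyapunov equation -/

section Lyapunov

variable {n : Type*} [Fintype n] {H S T : Matrix n n ℝ}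

/-- For positive definite `H` the homogeneous Lyapunov equation has only the zero solution: its
trace against `Tᵀ` is a sum of two nonnegative terms, and `tr (Tᵀ H T) = 0` forces `T = 0`. -/
theorem eq_zero_of_lyapunov (hH : H.PosDef) (h : H * T + T * H = 0) : T = 0 := by
  have p1 : (Tᵀ * H * T).PosSemidef := by
    simpa using hH.posSemidef.conjTranspose_mul_mul_same T
  have p2 : (T * H * Tᵀ).PosSemidef := by
    simpa using hH.posSemidef.mul_mul_conjTranspose_same T
  have htr : (Tᵀ * H * T).trace + (T * H * Tᵀ).trace = 0 := by
    rw [trace_mul_comm (T * H), ← trace_add, Matrix.mul_assoc Tᵀ H T, ← Matrix.mul_add, h,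
      Matrix.mul_zero, trace_zero]
  have h0 : Tᵀ * H * T = 0 := by
    rw [← p1.trace_eq_zero_iff]
    linarith [p1.trace_nonneg, p2.trace_nonneg]
  classical
  refine Matrix.ext_of_mulVec_single fun i => ?_
  rw [zero_mulVec]
  by_contra hne
  have hpos := hH.dotProduct_mulVec_pos hne
  have e : star (T *ᵥ Pi.single i 1) ⬝ᵥ H *ᵥ T *ᵥ Pi.single i 1 =
      Pi.single i 1 ⬝ᵥ (Tᵀ * H * T) *ᵥ Pi.single i 1 := by
    rw [star_trivial, Matrix.mul_assoc, ← mulVec_mulVec, ← mulVec_mulVec,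
      dotProduct_mulVec (Pi.single i 1) Tᵀ, vecMul_transpose]
  rw [e, h0, zero_mulVec, dotProduct_zero] at hpos
  exact lt_irrefl _ hpos

theorem exists_lyapunov_solution (hH : H.PosDef) (S : Matrix n n ℝ) :
    ∃ T, H * T + T * H = S := by
  let Φ : Matrix n n ℝ →ₗ[ℝ] Matrix n n ℝ := LinearMap.mulLeft ℝ H + LinearMap.mulRight ℝ H
  have hinj : Function.Injective Φ :=
    (injective_iff_map_eq_zero Φ).2 fun T hT => eq_zero_of_lyapunov hH hT
  exact LinearMap.injective_iff_surjective.1 hinj S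

theorem lyapunov_unique {T' : Matrix n n ℝ} (hH : H.PosDef) (h : H * T + T * H = S)
    (h' : H * T' + T' * H = S) : T = T' := by
  rw [← sub_eq_zero]
  refine eq_zero_of_lyapunov hH ?_
  rw [Matrix.mul_sub, Matrix.sub_mul, sub_add_sub_comm, h, h', sub_self]

theorem isHermitian_of_lyapunov (hH : H.PosDef) (hS : S.PosDef) (h : H * T + T * H = S) :
    T.IsHermitian := by
  refine lyapunov_unique hH ?_ h
  have := congrArg conjTranspose h
  rw [conjTranspose_add, conjTranspose_mul, conjTranspose_mul, hH.isHermitian.eq,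
    hS.isHermitian.eq, add_comm] at this
  exact this

theorem posSemidef_of_lyapunov (hH : H.PosDef) (hS : S.PosDef) (h : H * T + T * H = S) :
    T.PosSemidef := by
  classical
  have hT := isHermitian_of_lyapunov hH hS h
  rw [hT.posSemidef_iff_eigenvalues_nonneg]
  intro i
  -- On an eigenvector `v` with eigenvalue `μ` the equation reads `vᵀ S v = 2 μ vᵀ H v`.
  set v := (hT.eigenvectorBasis i).ofLp with hv
  have hv0 : v ≠ 0 := by
    intro h0
    have := hT.eigenvectorBasis.orthonormal.ne_zero i
    exact this (by ext j; exact congrFun h0 j)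
  have hTv : T *ᵥ v = hT.eigenvalues i • v := hT.mulVec_eigenvectorBasis i
  have h1 := hH.dotProduct_mulVec_pos hv0
  have h2 := hS.dotProduct_mulVec_pos hv0
  have hTt : Tᵀ = T := by simpa using hT.eq
  rw [star_trivial] at h1 h2
  have hvT : v ᵥ* T = hT.eigenvalues i • v := by rw [← mulVec_transpose, hTt, hTv]
  rw [← h, add_mulVec, dotProduct_add, ← mulVec_mulVec, ← mulVec_mulVec, hTv, mulVec_smul,
    dotProduct_smul, dotProduct_mulVec v T, hvT, smul_dotProduct, smul_eq_mul, ← two_mul] at h2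
  change 0 ≤ hT.eigenvalues i
  by_contra hneg
  push Not at hneg
  nlinarith [mul_neg_of_neg_of_pos hneg h1]

end Lyapunov

/-! ### The Gaussian law solving the integral equation -/

section QuadraticForms

variable {d : ℕ} {H S K : Matrix (Fin d) (Fin d) ℝ}

theorem exists_dotProduct_mulVec_le (M : Matrix (Fin d) (Fin d) ℝ) :
    ∃ c : ℝ, 0 ≤ c ∧ ∀ t : E d, t.ofLp ⬝ᵥ M *ᵥ t.ofLp ≤ c * ‖t‖ ^ 2 := by
  refine ⟨‖toEuclideanCLM (𝕜 := ℝ) M‖, norm_nonneg _, fun t => ?_⟩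
  rw [← inner_toEuclideanCLM]
  calc _ ≤ ‖t‖ * ‖toEuclideanCLM (𝕜 := ℝ) M t‖ := real_inner_le_norm _ _
    _ ≤ ‖t‖ * (‖toEuclideanCLM (𝕜 := ℝ) M‖ * ‖t‖) := by
      gcongr; exact ContinuousLinearMap.le_opNorm _ _
    _ = _ := by ring

theorem dotProduct_mulVec_comm (hK : K.IsHermitian) (x y : Fin d → ℝ) :
    x ⬝ᵥ K *ᵥ y = y ⬝ᵥ K *ᵥ x := by
  have hKt : Kᵀ = K := by simpa using hK.eq
  rw [dotProduct_mulVec, ← mulVec_transpose, hKt, dotProduct_comm]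

theorem two_mul_dotProduct_of_lyapunov (hH : H.IsHermitian) (hK : K.IsHermitian)
    (h : H * K + K * H = S) (t : Fin d → ℝ) :
    2 * (t ⬝ᵥ K *ᵥ H *ᵥ t) = t ⬝ᵥ S *ᵥ t := by
  have e : t ⬝ᵥ H *ᵥ K *ᵥ t = t ⬝ᵥ K *ᵥ H *ᵥ t := by
    rw [dotProduct_mulVec_comm hH, dotProduct_comm, dotProduct_mulVec_comm hK]
  rw [← h, add_mulVec, dotProduct_add, ← mulVec_mulVec, ← mulVec_mulVec, e, two_mul]

theorem quadratic_sub_of_lyapunov (hH : H.IsHermitian) (hK : K.IsHermitian)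
    (h : H * K + K * H = S) (α : ℝ) (t : Fin d → ℝ) :
    t ⬝ᵥ K *ᵥ t - (t - α • H *ᵥ t) ⬝ᵥ K *ᵥ (t - α • H *ᵥ t) =
      α * (t ⬝ᵥ S *ᵥ t) - α ^ 2 * ((H *ᵥ t) ⬝ᵥ K *ᵥ H *ᵥ t) := by
  rw [← two_mul_dotProduct_of_lyapunov hH hK h, mulVec_sub, mulVec_smul, dotProduct_sub,
    sub_dotProduct, sub_dotProduct, dotProduct_smul, dotProduct_smul, smul_dotProduct,
    smul_dotProduct, dotProduct_mulVec_comm hK (H *ᵥ t) t]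
  simp only [smul_eq_mul]
  ring

/-- The covariance matrix of a centered law represents its second-moment form. -/
theorem integral_sq_inner_eq {Ω : Type*} [MeasurableSpace Ω] {P : Measure Ω}
    [IsProbabilityMeasure P] {X : Ω → E d} (h2 : MemLp X 2 P) (h0 : ∫ ω, X ω ∂P = 0)
    (hcov : ∀ i j, covariance (fun ω => X ω i) (fun ω => X ω j) P = S i j) (t : E d) :
    ∫ ω, ⟪X ω, t⟫ ^ 2 ∂P = t.ofLp ⬝ᵥ S *ᵥ t.ofLp := by
  have hi : ∀ i, MemLp (fun ω => X ω i) 2 P := fun i =>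
    h2.continuousLinearMap_comp (EuclideanSpace.proj (𝕜 := ℝ) i)
  have hz : ∀ i, ∫ ω, X ω i ∂P = 0 := fun i => by
    rw [← eval_integral_piLp fun i => (hi i).integrable one_le_two, h0]; rfl
  have hS : ∀ i j, ∫ ω, X ω i * X ω j ∂P = S i j := fun i j => by
    rw [← hcov, covariance_eq_sub (hi i) (hi j), hz, zero_mul, sub_zero]; rfl
  have e : ∀ ω, ⟪X ω, t⟫ ^ 2 = ∑ i, ∑ j, t i * t j * (X ω i * X ω j) := fun ω => by
    rw [sq, PiLp.inner_apply, Finset.sum_mul_sum]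
    refine Finset.sum_congr rfl fun i _ => Finset.sum_congr rfl fun j _ => ?_
    simp only [RCLike.inner_apply, conj_trivial]
    ring
  have hint : ∀ i j, Integrable (fun ω => t i * t j * (X ω i * X ω j)) P := fun i j =>
    ((hi i).integrable_mul (hi j)).const_mul _
  simp_rw [e]
  rw [integral_finsetSum _ fun i _ => integrable_finsetSum _ fun j _ => hint i j]
  simp_rw [integral_finsetSum _ fun j _ => hint _ j, integral_const_mul, hS, dotProduct, mulVec,
    dotProduct, Finset.mul_sum]
  refine Finset.sum_congr rfl fun i _ => Finset.sum_congr rfl fun j _ => by ring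

/-- Differentiating the characteristic function of a centered Gaussian law in the direction `v`. -/
theorem integral_inner_mul_exp_multivariateGaussian (hK : K.PosSemidef) (t v : E d) :
    Complex.I * ∫ y, (⟪y, v⟫ : ℂ) * Complex.exp (⟪y, t⟫ * Complex.I) ∂multivariateGaussian 0 K =
      -((t.ofLp ⬝ᵥ K *ᵥ v.ofLp : ℝ) : ℂ) * charFun (multivariateGaussian 0 K) t := by
  have hmem : MemLp id (1 : ℕ) (multivariateGaussian 0 K) := by
    exact_mod_cast IsGaussian.memLp_id _ 1 ENNReal.one_ne_top
  have h1 := iteratedFDeriv_charFun (t := t) hmem fun _ => v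
  rw [iteratedFDeriv_one_apply] at h1
  have hd : DifferentiableAt ℝ (charFun (multivariateGaussian 0 K)) t :=
    ((contDiff_charFun hmem).differentiable (by norm_num)).differentiableAt
  rw [← hd.lineDeriv_eq_fderiv] at h1
  have h2 : HasDerivAt (fun τ : ℝ => charFun (multivariateGaussian 0 K) (t + τ • v))
      (-((t.ofLp ⬝ᵥ K *ᵥ v.ofLp : ℝ) : ℂ) * charFun (multivariateGaussian 0 K) t) 0 := by
    have e : (fun τ : ℝ => charFun (multivariateGaussian 0 K) (t + τ • v)) = fun τ : ℝ =>
        Complex.exp ((-((t.ofLp ⬝ᵥ K *ᵥ t.ofLp) + 2 * τ * (t.ofLp ⬝ᵥ K *ᵥ v.ofLp) +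
          τ ^ 2 * (v.ofLp ⬝ᵥ K *ᵥ v.ofLp)) / 2 : ℝ)) := by
      ext τ
      rw [charFun_multivariateGaussian hK, inner_zero_right, WithLp.ofLp_add, WithLp.ofLp_smul,
        mulVec_add, mulVec_smul, add_dotProduct, dotProduct_add, dotProduct_add, smul_dotProduct,
        smul_dotProduct, dotProduct_smul, dotProduct_smul,
        dotProduct_mulVec_comm hK.isHermitian v.ofLp t.ofLp]
      congr 1
      push_cast
      simp only [smul_eq_mul, Complex.ofReal_mul]
      ring
    have hp : HasDerivAt (fun τ : ℝ => -((t.ofLp ⬝ᵥ K *ᵥ t.ofLp) +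
        2 * τ * (t.ofLp ⬝ᵥ K *ᵥ v.ofLp) + τ ^ 2 * (v.ofLp ⬝ᵥ K *ᵥ v.ofLp)) / 2)
        (-(t.ofLp ⬝ᵥ K *ᵥ v.ofLp)) 0 := by
      have := (((((hasDerivAt_id (0 : ℝ)).const_mul 2).mul_const (t.ofLp ⬝ᵥ K *ᵥ v.ofLp)).const_add
        (t.ofLp ⬝ᵥ K *ᵥ t.ofLp)).add (((hasDerivAt_id (0 : ℝ)).pow 2).mul_const
        (v.ofLp ⬝ᵥ K *ᵥ v.ofLp))).neg.div_const 2
      convert! this using 1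
      simp; ring
    rw [e, charFun_multivariateGaussian hK]
    have h3 := hp.ofReal_comp.cexp
    convert! h3 using 1
    rw [mul_comm]
    simp [neg_div]
  have h3 : lineDeriv ℝ (charFun (multivariateGaussian 0 K)) t v =
      -((t.ofLp ⬝ᵥ K *ᵥ v.ofLp : ℝ) : ℂ) * charFun (multivariateGaussian 0 K) t := h2.deriv
  rw [h3] at h1
  rw [h1]
  simp

theorem solvesEquation_multivariateGaussian (hH : H.IsHermitian) (hK : K.PosSemidef)
    (h : H * K + K * H = S) : SolvesEquation S H ⟨multivariateGaussian 0 K, inferInstance⟩ := by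
  intro t
  change Integrable _ (multivariateGaussian 0 K) ∧ ∫ y, _ ∂multivariateGaussian 0 K = 0
  set v : E d := WithLp.toLp 2 (H *ᵥ t.ofLp) with hv
  have e : integrand S H t = fun y => ((t.ofLp ⬝ᵥ S *ᵥ t.ofLp : ℝ) : ℂ) *
      Complex.exp (⟪y, t⟫ * Complex.I) +
      2 * Complex.I * ((⟪y, v⟫ : ℂ) * Complex.exp (⟪y, t⟫ * Complex.I)) := by
    ext y
    have e1 : t.ofLp ⬝ᵥ y.ofLp = ⟪y, t⟫ := by
      rw [EuclideanSpace.inner_eq_star_dotProduct, star_trivial]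
    have e2 : t.ofLp ⬝ᵥ H *ᵥ y.ofLp = ⟪y, v⟫ := by
      rw [EuclideanSpace.inner_eq_star_dotProduct, star_trivial, dotProduct_mulVec_comm hH,
        dotProduct_comm]
    rw [integrand, e1, e2, mul_comm Complex.I (⟪y, t⟫ : ℂ)]
    ring
  have hid : Integrable (fun y : E d => y) (multivariateGaussian 0 K) :=
    IsGaussian.integrable_fun_id
  have i1 : Integrable (fun y : E d => Complex.exp (⟪y, t⟫ * Complex.I))
      (multivariateGaussian 0 K) := by
    refine (integrable_const (1 : ℝ)).mono' (by fun_prop) (Eventually.of_forall fun x => ?_)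
    rw [Complex.norm_exp_ofReal_mul_I]
  have i2 : Integrable (fun y : E d => (⟪y, v⟫ : ℂ) * Complex.exp (⟪y, t⟫ * Complex.I))
      (multivariateGaussian 0 K) := by
    have hin : Integrable (fun y : E d => ⟪y, v⟫) (multivariateGaussian 0 K) := hid.inner_const v
    refine hin.norm.mono' (by fun_prop) (Eventually.of_forall fun x => ?_)
    rw [norm_mul, Complex.norm_exp_ofReal_mul_I, mul_one, Complex.norm_real]
  rw [e]
  refine ⟨(i1.const_mul _).add (i2.const_mul _), ?_⟩
  rw [integral_add (i1.const_mul _) (i2.const_mul _), integral_const_mul, integral_const_mul,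
    ← charFun_apply, mul_assoc, integral_inner_mul_exp_multivariateGaussian hK,
    ← two_mul_dotProduct_of_lyapunov hH hK.isHermitian h]
  push_cast
  ring

end QuadraticForms

section ScaledSgd

variable {d : ℕ} {f : E d → ℝ} {L σ : ℝ}

/-! ### The Hessian matrix -/

theorem toEuclideanCLM_hessianMatrix (hf : TwiceDifferentiable f) (x : E d) :
    toEuclideanCLM (𝕜 := ℝ) (hessianMatrix f x) = hessianCLM f x := by
  ext1 v
  refine ext_inner_left ℝ fun u => ?_
  rw [inner_toEuclideanCLM, dotProduct_hessianMatrix_mulVec, hessianCLM_symm hf]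

theorem ofLp_hessianCLM (hf : TwiceDifferentiable f) (x v : E d) :
    (hessianCLM f x v).ofLp = hessianMatrix f x *ᵥ v.ofLp := by
  rw [← toEuclideanCLM_hessianMatrix hf, ofLp_toEuclideanCLM]

theorem posDef_hessianMatrix (hσ : 0 < σ) (hL : 0 < L) (hc : IsStronglyConvex σ f)
    (hs : IsSmooth L f) (hf : TwiceDifferentiable f) (x : E d) : (hessianMatrix f x).PosDef := by
  refine PosDef.of_dotProduct_mulVec_pos ?_ fun v hv => ?_
  · rw [IsHermitian, conjTranspose_eq_transpose_of_trivial, hessianMatrix_transpose hf]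
  · have := dotProduct_hessianMatrix_mulVec f x (WithLp.toLp 2 v) (WithLp.toLp 2 v)
    rw [star_trivial]
    refine this ▸ inner_hessianCLM_pos hσ hL hc hs hf x ?_
    intro h
    exact hv (congrArg WithLp.ofLp h)

/-! ### Limit laws of stochastic gradient descent -/

section Noise

theorem scaledSgd_eq_arIter {Ω : Type*} [MeasurableSpace Ω] (f : E d → ℝ)
    (w : ℕ → Ω → E d) (xs : E d) {α : ℝ} (hα : 0 < α)
    (x₀ : E d) (k : ℕ) (ω : Ω) :
    scaledSgd f w xs α x₀ k ω =
      arIter (scaledStep f xs α) ((√α)⁻¹ • (x₀ - xs)) k fun i => √α • w i ω := by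
  have hq : √α ≠ 0 := (Real.sqrt_pos.mpr hα).ne'
  induction k with
  | zero => rfl
  | succ k ih =>
    rw [arIter, ← ih, scaledSgd, scaledSgd, scaledStep, smul_inv_smul₀ hq, add_sub_cancel, sgd,
      gradStep]
    have e : √α • w k ω = (√α)⁻¹ • α • w k ω := by
      rw [smul_smul, ← div_eq_inv_mul, Real.div_sqrt]
    rw [e, ← smul_add]
    congr 1
    simp only [smul_add, smul_neg]
    abel

variable {Ω : Type*} [MeasurableSpace Ω] {P : Measure Ω} {w : ℕ → Ω → E d}
  {S : Matrix (Fin d) (Fin d) ℝ}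

theorem IsNoise.iIndepFun_smul (hw : IsNoise P w S) (c : ℝ) :
    iIndepFun (fun k ω => c • w k ω) P :=
  hw.indep.comp (fun _ x => c • x) fun _ => measurable_const_smul c

theorem IsNoise.identDistrib_smul (hw : IsNoise P w S) (c : ℝ) (k : ℕ) :
    IdentDistrib (fun ω => c • w k ω) (fun ω => c • w 0 ω) P P :=
  (hw.identDistrib k).comp (measurable_const_smul c)

theorem IsNoise.memLp_smul (hw : IsNoise P w S) (c : ℝ) :
    MemLp (fun ω => c • w 0 ω) 2 P := hw.memLp.const_smul c

variable [IsProbabilityMeasure P]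

theorem exists_limit_law_scaledSgd (hw : IsNoise P w S) (hσ : 0 < σ) (hL : 0 < L)
    (hc : IsStronglyConvex σ f) (hs : IsSmooth L f) {xs : E d} (hg : gradient f xs = 0) {α : ℝ}
    (hα : 0 < α) (hαL : α * L ≤ 1) (hασ : α * σ ≤ 1) :
    ∃ μ : ProbabilityMeasure (E d),
      (∀ x₀, TendstoInDistribution (fun k => scaledSgd f w xs α x₀ k) atTop (id : E d → E d)
        (fun _ => P) (μ : Measure (E d))) ∧
      ∫⁻ y, ‖y‖ₑ ^ 2 ∂(μ : Measure (E d)) < ⊤ := by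
  have hq : (1 - α * σ / 2).toNNReal < 1 := by
    rw [← NNReal.coe_lt_coe, Real.coe_toNNReal _ (by linarith)]
    have : 0 < α * σ := by positivity
    simp only [NNReal.coe_one]; linarith
  obtain ⟨μ, h1, h2⟩ := exists_limit_law (lipschitzWith_scaledStep hσ hL hc hs hα hαL hασ xs)
    (scaledStep_zero hg) hq (hw.iIndepFun_smul (√α)) (hw.identDistrib_smul (√α))
    (hw.memLp_smul (√α))
  refine ⟨μ, fun x₀ => ?_, h2⟩
  have e : (fun k => scaledSgd f w xs α x₀ k) = fun k ω =>
      arIter (scaledStep f xs α) ((√α)⁻¹ • (x₀ - xs)) k fun i => √α • w i ω := by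
    ext1 k; ext1 ω; exact scaledSgd_eq_arIter f w xs hα x₀ k ω
  rw [e]
  exact h1 _

/-- The characteristic functions of the limit laws approach that of the Gaussian law whose
covariance matrix solves the Lyapunov equation, as the stepsize tends to zero. -/
theorem eventually_norm_charFun_limit_sub_le (hw : IsNoise P w S) (hσ : 0 < σ) (hL : 0 < L)
    (hc : IsStronglyConvex σ f) (hs : IsSmooth L f) (hf : TwiceDifferentiable f) {xs : E d}
    (hg : gradient f xs = 0) {K : Matrix (Fin d) (Fin d) ℝ} (hK : K.PosSemidef)
    (hHK : hessianMatrix f xs * K + K * hessianMatrix f xs = S) (t : E d) {ε : ℝ} (hε : 0 < ε) :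
    ∀ᶠ α in 𝓝[>] (0 : ℝ), ∀ μ : ProbabilityMeasure (E d),
      TendstoInDistribution (fun k => scaledSgd f w xs α xs k) atTop (id : E d → E d)
        (fun _ => P) (μ : Measure (E d)) →
      ‖charFun (μ : Measure (E d)) t - charFun (multivariateGaussian 0 K) t‖ ≤ ε := by
  set H := hessianCLM f xs with hH
  have hHm := posDef_hessianMatrix hσ hL hc hs hf xs
  have hw0 : AEMeasurable (w 0) P := hw.memLp.1.aemeasurable
  set ν := P.map (w 0) with hν
  have : IsProbabilityMeasure ν := Measure.isProbabilityMeasure_map hw0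
  have hν2 : MemLp id 2 ν := by
    rw [hν, memLp_map_measure_iff aestronglyMeasurable_id hw0]
    exact hw.memLp
  have hν0 : ∫ x, x ∂ν = 0 := by
    rw [hν, integral_map hw0 (by fun_prop), hw.mean_zero]
  have hνS : ∀ t : E d, ∫ x, ⟪x, t⟫ ^ 2 ∂ν = t.ofLp ⬝ᵥ S *ᵥ t.ofLp := fun t => by
    rw [hν, integral_map hw0 (by fun_prop), integral_sq_inner_eq hw.memLp hw.mean_zero
      hw.covariance_eq]
  obtain ⟨cK, hcK, hKle⟩ := exists_dotProduct_mulVec_le K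
  obtain ⟨cS, hcS, hSle⟩ := exists_dotProduct_mulVec_le S
  set Q : E d → ℝ := fun t => t.ofLp ⬝ᵥ K *ᵥ t.ofLp with hQ
  have hQ0 : ∀ t, 0 ≤ Q t := fun t => by simpa using hK.dotProduct_mulVec_nonneg t.ofLp
  set g : E d → ℂ := fun t => Complex.exp (-(Q t / 2 : ℝ)) with hg_def
  have hgK : ∀ t, charFun (multivariateGaussian 0 K) t = g t := fun t => by
    rw [charFun_multivariateGaussian hK, hg_def, inner_zero_right]
    simp [hQ]
  set R := ‖t‖ + 1 with hR
  have hR0 : 0 < R := by positivity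
  set W := ∫ ω, ‖w 0 ω‖ ^ 2 ∂P with hW
  have hW0 : 0 ≤ W := integral_nonneg fun ω => by positivity
  -- Two errors `α ε'` per step accumulate to `2 α ε' / (α σ / 2) = ε / R`.
  set ε' := ε * σ / (4 * R) with hε'
  have hε'0 : 0 < ε' := by positivity
  have hev1 := eventually_norm_gaussian_step_le hν2 hν0 (Q := Q) (H := H)
    (c := cK * ‖H‖ ^ 2 + cS) (by positivity) hQ0
    (fun t => by
      calc Q (H t) ≤ cK * ‖H t‖ ^ 2 := hKle _
        _ ≤ cK * (‖H‖ * ‖t‖) ^ 2 := by gcongr; exact H.le_opNorm t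
        _ = cK * ‖H‖ ^ 2 * ‖t‖ ^ 2 := by ring
        _ ≤ _ := by gcongr; linarith)
    (fun t => by
      rw [hνS]
      refine (hSle t).trans ?_
      have : 0 ≤ cK * ‖H‖ ^ 2 := by positivity
      gcongr; linarith)
    (fun α t => by
      rw [hνS]
      simp only [hQ, WithLp.ofLp_sub, WithLp.ofLp_smul, hH, ofLp_hessianCLM hf]
      exact quadratic_sub_of_lyapunov hHm.isHermitian hK.isHermitian hHK α t.ofLp)
    hR0 hε'0
  have hev2 := eventually_integral_norm_scaledStep_sub_le hσ.le hL hc hs hf hg P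
    (M := 2 * W / σ) (by positivity) hε'0
  have hev3 : ∀ᶠ α in 𝓝[>] (0 : ℝ), α < (L + σ)⁻¹ :=
    (tendsto_id.mono_left nhdsWithin_le_nhds).eventually_lt_const (by positivity)
  filter_upwards [hev1, hev2, hev3, self_mem_nhdsWithin] with α h1 h2 h3 hα μ hμ
  have hα : 0 < α := hα
  have hαLσ : α * (L + σ) < 1 := by
    rwa [lt_inv_comm₀ hα (by positivity), ← one_div, lt_div_iff₀ hα, mul_comm] at h3
  have hασ0 : 0 < α * σ := by positivity
  have hαL0 : 0 < α * L := by positivity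
  have hαL : α * L ≤ 1 := by linarith
  have hασ : α * σ ≤ 1 := by linarith
  have hT := lipschitzWith_scaledStep hσ hL hc hs hα hαL hασ xs
  have hT0 : scaledStep f xs α 0 = 0 := scaledStep_zero hg
  set q : ℝ := 1 - α * σ / 2 with hq
  have hq0 : 0 ≤ q := by rw [hq]; linarith
  have hq1 : q < 1 := by rw [hq]; linarith
  have hi := hw.iIndepFun_smul (√α)
  have hd := hw.identDistrib_smul (√α)
  have hm := hw.memLp_smul (√α)
  set ξ : ℕ → Ω → E d := fun k ω => √α • w k ω with hξ
  have hξ0 : ∫ ω, ξ 0 ω ∂P = 0 := by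
    simp only [hξ]
    rw [integral_smul, hw.mean_zero, smul_zero]
  have hξ2 : ∫ ω, ‖ξ 0 ω‖ ^ 2 ∂P = α * W := by
    simp only [hξ, norm_smul, Real.norm_of_nonneg (Real.sqrt_nonneg α), mul_pow,
      Real.sq_sqrt hα.le]
    rw [integral_const_mul]
  -- `2 W / σ` bounds the second moments: `q² ≤ q = 1 - α σ / 2` and the noise contributes `α W`.
  have hmom := integral_sq_norm_arIter_le hT hT0 hi hd hm hξ0 (M := 2 * W / σ) (by positivity) (by
    rw [hξ2, Real.coe_toNNReal _ hq0]
    have e : q * (2 * W / σ) + α * W = 2 * W / σ := by rw [hq]; field_simp; ring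
    have : q ^ 2 * (2 * W / σ) ≤ q * (2 * W / σ) := by
      gcongr; exact pow_le_of_le_one hq0 hq1.le two_ne_zero
    linarith)
  have hmemY := memLp_arIter hT hT0 hd hm
  set A : E d →L[ℝ] E d := ContinuousLinearMap.id ℝ (E d) - α • H with hA
  have hAapp : ∀ v, A v = v - α • H v := fun v => by simp [hA]
  have hgbound : ∀ s : E d, ‖s‖ ≤ R → ‖1 - g s‖ ≤ cK * R * ‖s‖ := fun s hs' => by
    have e : (1 : ℂ) - g s = ((1 - Real.exp (-(Q s / 2)) : ℝ) : ℂ) := by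
      simp [hg_def]
    have h4 : 0 ≤ 1 - Real.exp (-(Q s / 2)) := by
      have : Real.exp (-(Q s / 2)) ≤ 1 := Real.exp_le_one_iff.2 (by linarith [hQ0 s])
      linarith
    rw [e, Complex.norm_real, Real.norm_of_nonneg h4]
    calc 1 - Real.exp (-(Q s / 2)) ≤ Q s / 2 := by linarith [Real.one_sub_le_exp_neg (Q s / 2)]
      _ ≤ Q s := by linarith [hQ0 s]
      _ ≤ cK * ‖s‖ ^ 2 := hKle s
      _ = cK * ‖s‖ * ‖s‖ := by ring
      _ ≤ cK * R * ‖s‖ := by gcongr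
  have key := fun k => norm_charFun_arIter_sub_le (T := scaledStep f xs α) (A := A) (g := g)
    (q := q) (C := cK * R) (R := R) (η₁ := α * ε') (η₂ := α * ε') hT.continuous.measurable hi hd
    (fun x y => by
      rw [hAapp, hAapp, inner_sub_left, inner_sub_right, real_inner_smul_left,
        real_inner_smul_right, hessianCLM_symm hf])
    (fun x => by
      rw [hAapp]; exact norm_sub_smul_hessianCLM_le hσ hL hc hs hf hα hαL hασ xs x)
    hq0 hq1 (fun k => by simpa only [hAapp] using (h2 _ (hmemY k) (hmom k)).1)
    (fun k => by simpa only [hAapp] using (h2 _ (hmemY k) (hmom k)).2)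
    (fun s hs' => by
      have := h1 s hs'
      rw [hν, ← charFun_map_smul_comp hw0, ← hAapp] at this
      exact this)
    (by positivity) (by positivity) hgbound k (t := t) (by rw [hR]; linarith)
  -- Let the number of steps tend to infinity.
  have hlim := ProbabilityMeasure.tendsto_iff_tendsto_charFun.mp hμ.tendsto t
  have hmap : (μ : Measure (E d)).map id = (μ : Measure (E d)) := Measure.map_id
  have hlim2 : Tendsto (fun k => charFun (P.map fun ω => arIter (scaledStep f xs α) 0 k
      fun i => ξ i ω) t) atTop (𝓝 (charFun (μ : Measure (E d)) t)) := by
    have e : ∀ k, scaledSgd f w xs α xs k = fun ω => arIter (scaledStep f xs α) 0 k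
        fun i => ξ i ω := fun k => by
      ext1 ω
      rw [scaledSgd_eq_arIter f w xs hα, sub_self, smul_zero]
    simp only [e, ProbabilityMeasure.coe_mk, hmap] at hlim
    exact hlim
  have hrhs : Tendsto (fun k : ℕ => (cK * R * q ^ k + (α * ε' + α * ε') / (1 - q)) * ‖t‖) atTop
      (𝓝 ((cK * R * 0 + (α * ε' + α * ε') / (1 - q)) * ‖t‖)) :=
    (((tendsto_pow_atTop_nhds_zero_of_lt_one hq0 hq1).const_mul _).add_const _).mul_const _
  have hfin := le_of_tendsto_of_tendsto' (hlim2.sub_const (g t)).norm hrhs key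
  rw [hgK]
  refine hfin.trans ?_
  have e : (cK * R * 0 + (α * ε' + α * ε') / (1 - q)) * ‖t‖ = ε * (‖t‖ / R) := by
    rw [hq, hε']; field_simp; ring
  rw [e]
  refine mul_le_of_le_one_right hε.le ?_
  rw [div_le_one hR0, hR]
  linarith

end Noise

end ScaledSgd

end SGDLimit

theorem theorem1 {d : ℕ} {Ω : Type*} [MeasurableSpace Ω] (P : Measure Ω) [IsProbabilityMeasure P]
    (w : ℕ → Ω → SGDLimit.E d) (S : Matrix (Fin d) (Fin d) ℝ) (hw : SGDLimit.IsNoise P w S)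
    (f : SGDLimit.E d → ℝ) (L σ : ℝ) (hσ : 0 < σ)
    (hf : SGDLimit.TwiceDifferentiable f)
    (hsmooth : SGDLimit.IsSmooth L f) (hconv : SGDLimit.IsStronglyConvex σ f) :
    (∃! xs : SGDLimit.E d, ∀ x, f xs ≤ f x) ∧
    ∀ xs : SGDLimit.E d, (∀ x, f xs ≤ f x) →
      ∃ αbar : ℝ, 0 < αbar ∧ ∃ law : ℝ → ProbabilityMeasure (SGDLimit.E d),
        -- (1) `law α` is the law of the weak limit of the scaled iterates
        (∀ α ∈ Set.Ioo 0 αbar,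
          (∀ x₀ : SGDLimit.E d,
            TendstoInDistribution (fun k => SGDLimit.scaledSgd f w xs α x₀ k) atTop
              (id : SGDLimit.E d → SGDLimit.E d) (fun _ => P)
              (law α : Measure (SGDLimit.E d))) ∧
          ∫⁻ y, ‖y‖ₑ ^ 2 ∂(law α : Measure (SGDLimit.E d)) < ⊤) ∧
        -- (2) `lawY` is the law of the weak limit as the stepsize tends to zero
        ∃ lawY : ProbabilityMeasure (SGDLimit.E d),
          (∀ a : ℕ → ℝ, (∀ i, a i ∈ Set.Ioo 0 αbar) → Tendsto a atTop (𝓝 0) →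
            Tendsto (fun i => law (a i)) atTop (𝓝 lawY)) ∧
          SGDLimit.SolvesEquation S (SGDLimit.hessianMatrix f xs) lawY ∧
          ∃ SY : Matrix (Fin d) (Fin d) ℝ,
            (∀ T : Matrix (Fin d) (Fin d) ℝ,
              SGDLimit.hessianMatrix f xs * T + T * (SGDLimit.hessianMatrix f xs)ᵀ = S ↔
                T = SY) ∧
            SY.PosSemidef ∧
            ((∃! μ : ProbabilityMeasure (SGDLimit.E d),
                SGDLimit.SolvesEquation S (SGDLimit.hessianMatrix f xs) μ) →
              (lawY : Measure (SGDLimit.E d)) = multivariateGaussian 0 SY) := by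
  -- The maximum with `1` makes the smoothness constant positive also for `d = 0`.
  have hs := hsmooth.mono (le_max_left L 1)
  set M := max L 1
  have hM : 0 < M := lt_max_of_lt_right one_pos
  refine ⟨SGDLimit.existsUnique_forall_le hσ hM hconv hs, fun xs hxs => ?_⟩
  have hg := SGDLimit.gradient_eq_zero_of_forall_le hxs
  have hH := SGDLimit.posDef_hessianMatrix hσ hM hconv hs hf xs
  have hHt := SGDLimit.hessianMatrix_transpose hf xs
  obtain ⟨SY, hSY⟩ := SGDLimit.exists_lyapunov_solution hH S
  have hSYpos := SGDLimit.posSemidef_of_lyapunov hH hw.posDef hSY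
  have hstep : ∀ α ∈ Set.Ioo 0 (M + σ)⁻¹, α * M ≤ 1 ∧ α * σ ≤ 1 := fun α hα => by
    have hMσ : 0 < M + σ := by positivity
    have h1 : α * (M + σ) < 1 := by
      simpa [hMσ.ne'] using mul_lt_mul_of_pos_right hα.2 hMσ
    have h2 : 0 < α * M := mul_pos hα.1 hM
    have h3 : 0 < α * σ := mul_pos hα.1 hσ
    constructor <;> linarith
  have hlaw : ∀ α : ℝ, ∃ μ : ProbabilityMeasure (SGDLimit.E d), α ∈ Set.Ioo 0 (M + σ)⁻¹ →
      (∀ x₀, TendstoInDistribution (fun k => SGDLimit.scaledSgd f w xs α x₀ k) atTop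
        (id : SGDLimit.E d → SGDLimit.E d) (fun _ => P) (μ : Measure (SGDLimit.E d))) ∧
      ∫⁻ y, ‖y‖ₑ ^ 2 ∂(μ : Measure (SGDLimit.E d)) < ⊤ := fun α => by
    by_cases hα : α ∈ Set.Ioo 0 (M + σ)⁻¹
    · obtain ⟨μ, hμ⟩ := SGDLimit.exists_limit_law_scaledSgd hw hσ hM hconv hs hg hα.1
        (hstep α hα).1 (hstep α hα).2
      exact ⟨μ, fun _ => hμ⟩
    · exact ⟨⟨Measure.dirac 0, inferInstance⟩, fun h => absurd h hα⟩
  choose law hlaw using hlaw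
  refine ⟨(M + σ)⁻¹, by positivity, law, hlaw, ⟨multivariateGaussian 0 SY, inferInstance⟩,
    fun a ha ha0 => ?_, SGDLimit.solvesEquation_multivariateGaussian hH.isHermitian hSYpos hSY,
    SY, fun T => ?_, hSYpos, fun _ => rfl⟩
  · refine ProbabilityMeasure.tendsto_of_tendsto_charFun fun t => ?_
    rw [Metric.tendsto_atTop']
    intro ε hε
    have hev := SGDLimit.eventually_norm_charFun_limit_sub_le hw hσ hM hconv hs hf hg hSYpos hSY t
      (half_pos hε)
    have ha' : Tendsto a atTop (𝓝[>] 0) :=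
      tendsto_nhdsWithin_iff.2 ⟨ha0, Eventually.of_forall fun i => (ha i).1⟩
    obtain ⟨N, hN⟩ := eventually_atTop.1 (ha'.eventually hev)
    refine ⟨N, fun i hi => ?_⟩
    rw [dist_eq_norm]
    exact (hN i hi.le _ ((hlaw _ (ha i)).1 xs)).trans_lt (half_lt_self hε)
  · rw [hHt]
    exact ⟨fun hT => SGDLimit.lyapunov_unique hH hT hSY, fun hT => hT ▸ hSY⟩
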